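/- **Setting.** There are $n=3f+1$ processes $\Pi=\{p_1,\dots,p_n\}$ in an asynchronous system. An adaptive adversary schedules all events and may corrupt up to $f$ processes during the run. A process is *correct* if it is never corrupted; every process follows the code until it is corrupted and is arbitrary afterwards. A run is an infinite sequence of events; correct processes keep executing their code, and each of them calls $a\_bcast(b,r)$ for infinitely many blocks $b$, with consecutive sequence numbers $r=1,2,\dots$ (blocks come from a countable set). *Reliable broadcast* ($r\_bcast_k(m,r)$, $r\_deliver_i(m,r,p_k)$), almost surely: if a correct process outputs $r\_deliver(m,r,p_k)$, then every correct process eventually does; a correct process outputs $r\_deliver(\cdot,r,p_k)$ at most once for each $(r,k)$; if a correct $p_k$ calls $r\_bcast_k(m,r)$, then every correct process eventually outputs $r\_deliver(m,r,p_k)$. *Global perfect coin* with leaders $X_w$, $w\in\mathbb N$. Let $\mathcal F_t$ be the information on the basis of which the $t$-th event is scheduled (so the $t$-th event is $\mathcal F_t$-measurable). Almost surely, every value returned by $choose\_leader(w)$ to a process not yet corrupted is $X_w$; if at least $f+1$ processes call $choose\_leader(w)$, every such call by a correct process returns; as long as fewer than $f+1$ processes have called $choose\_leader(w)$ before event $t$,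 $\Pr[X_w=p_j\mid\mathcal F_t]\le\Pr[X_w=p_j]+\varepsilon$ for every $p_j$; and $\Pr[X_w=p_j]=1/n$. Here $\varepsilon\ge 0$ is small enough that $f\,(1/n+\varepsilon)<1$. **Protocol DAG-Rider**, code of $p_i$. A vertex $v$ has a round, a source, a block, a set of strong edges to vertices of round $v.round-1$ and a set of weak edges to vertices of rounds $<v.round-1$; an edge refers to a vertex by its round and source. $DAG[0]$ is a fixed set of $2f+1$ vertices without edges and with distinct sources, all other $DAG[r]$ are initially empty; the round $r$ is initially $0$. A path (strong path) from $v$ to $u$ follows edges (strong edges) to vertices of $\bigcup_{r\ge1}DAG[r]$, and may have length $0$. * $a\_bcast(b,r)$: append $b$ to a queue. * $r\_deliver(v,r',p_k)$: set $v.round=r'$ and $v.source=p_k$; if $v$ has at least $2f+1$ strong edges and its edges lead to rounds as above, put $v$ into a buffer. * A buffered vertex with $v.round\le r$ all of whose edges lead to vertices already in the DAG (round $0$ included) is moved to $DAG[v.round]$. * When $|DAG[r]|\ge 2f+1$: if $4\mid r$, signal $wave\_ready(r/4)$; set $r\leftarrow r+1$; as soon as the queue is non-empty, $r\_bcast$ a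 vertex of round $r$ with the first block of the queue, strong edges to all of $DAG[r-1]$, and weak edges added, for rounds $r-2$ down to $1$, to all vertices of the DAG to which there is no path yet. * $wave\_ready(w)$ (signals are handled one after the other): with $round(w,k)=4(w-1)+k$, the leader vertex of wave $w$ is the vertex of $DAG[round(w,1)]$ whose source is the value of $choose\_leader(w)$, if there is one. If it does not exist, or fewer than $2f+1$ vertices of $DAG[round(w,4)]$ have a strong path to it, do nothing. Otherwise push it on a stack and call it $v$; for $w'=w-1$ down to $decidedWave+1$ (initially $decidedWave=0$), if the leader vertex $v'$ of $w'$ exists and there is a strong path from $v$ to $v'$, push $v'$ and set $v\leftarrow v'$. Set $decidedWave\leftarrow w$. Then pop the vertices $v$ from the stack one by one, and for each, in a fixed deterministic order, output $a\_deliver_i(u.block,u.round,u.source)$ for all not yet delivered $u$ in the DAG, of round $\geq 1$, to which there is a path from $v$. **Proposition (agreement).** With probability $1$, for all correct processes $p_i,p_j$ and all $b,r,p_k$: if $p_i$ outputs $a\_deliver_i(b,r,p_k)$, then $p_j$ eventually outputs $a\_deliver_j(b,r,p_k)$. -/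

import Mathlib

/-! # DAG-Rider: the protocol, its runs and its building blocks

There are `n = 3 f + 1` processes.  A run is an infinite sequence of events; the local state of
every process is a function of the events that precede.  -/

namespace DagRider

noncomputable section

open MeasureTheory
open scoped Classical

/-- The `n = 3 f + 1` processes. -/
abbrev Proc (f : ℕ) : Type := Fin (3 * f + 1)

/-- A reference to a vertex: its round and its source. -/
abbrev Ref (f : ℕ) : Type := ℕ × Proc f

/-- A vertex of the DAG.  Edges are stored as references (round, source) to their endpoints. -/
structure Vertex (f : ℕ) (B : Type*) where
  round : ℕ
  source : Proc f
  block : B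
  strongEdges : Finset (Ref f)
  weakEdges : Finset (Ref f)

variable {f : ℕ} {B : Type*}

/-- The reference to a vertex. -/
def Vertex.ref (v : Vertex f B) : Ref f := (v.round, v.source)

/-- The check made on reception: at least `2 f + 1` strong edges, all of them to the previous
round, and weak edges only to rounds before the previous one. -/
def Vertex.WellFormed (v : Vertex f B) : Prop :=
  2 * f + 1 ≤ v.strongEdges.card ∧
    (∀ e ∈ v.strongEdges, e.1 + 1 = v.round) ∧ (∀ e ∈ v.weakEdges, e.1 + 1 < v.round)

/-- What is fixed in the code of all processes: the `2 f + 1` predefined vertices of round 0, and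
the deterministic order in which a set of vertices is delivered. -/
structure Params (f : ℕ) (B : Type*) where
  genesis : Finset (Vertex f B)
  genesis_card : genesis.card = 2 * f + 1
  genesis_round : ∀ v ∈ genesis, v.round = 0
  genesis_edges : ∀ v ∈ genesis, v.strongEdges = ∅ ∧ v.weakEdges = ∅
  genesis_source : ∀ v ∈ genesis, ∀ u ∈ genesis, v.source = u.source → v = u
  order : Finset (Vertex f B) → List (Vertex f B)
  order_spec : ∀ S : Finset (Vertex f B), (order S : Multiset (Vertex f B)) = S.val

/-! ## Paths in a DAG -/

/-- `D[r]`, the vertices of round `r`. -/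
def layer (D : Finset (Vertex f B)) (r : ℕ) : Finset (Vertex f B) :=
  D.filter fun v => v.round = r

/-- `D[round(w, k)]` where `round(w, k) = 4 (w - 1) + k` (an integer, negative if `w = 0` and
`k < 4`, in which case the set is empty). -/
def waveLayer (D : Finset (Vertex f B)) (w k : ℕ) : Finset (Vertex f B) :=
  D.filter fun v => v.round + 4 = 4 * w + k

/-- The procedure `strong_path(v, u)`. -/
def StrongPath (D : Finset (Vertex f B)) : Vertex f B → Vertex f B → Prop :=
  Relation.ReflTransGen fun v u => u ∈ D ∧ 1 ≤ u.round ∧ u.ref ∈ v.strongEdges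

/-- The procedure `path(v, u)`. -/
def Path (D : Finset (Vertex f B)) : Vertex f B → Vertex f B → Prop :=
  Relation.ReflTransGen fun v u => u ∈ D ∧ 1 ≤ u.round ∧ u.ref ∈ v.weakEdges ∪ v.strongEdges

/-! ## Local states and the code of a process -/

/-- The local variables of a process. -/
structure LocalState (f : ℕ) (B : Type*) where
  /-- number of calls to `a_bcast` so far -/
  seq : ℕ
  /-- the queue `blocksToPropose` -/
  blocksToPropose : List B
  /-- the current round `r` -/
  round : ℕ
  /-- the round has been entered, but its vertex has not yet been created and broadcast -/
  creating : Prop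
  buffer : Finset (Vertex f B)
  /-- the union of the sets `DAG[r]` -/
  dag : Finset (Vertex f B)
  /-- the signals `wave_ready(w)` whose handler has not yet finished, oldest first -/
  waveQueue : List ℕ
  /-- the handler of the oldest signal waits for the return of its call of the coin -/
  waiting : Prop
  /-- the values that the coin has returned -/
  coins : ℕ → Option (Proc f)
  decidedWave : ℕ
  deliveredVertices : Finset (Vertex f B)
  /-- the outputs `a_deliver(b, r, p_k)` so far, in their order -/
  outputs : List (B × ℕ × Proc f)

/-- The initial local state. -/
def initState (P : Params f B) : LocalState f B where
  seq := 0
  blocksToPropose := []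
  round := 0
  creating := False
  buffer := ∅
  dag := P.genesis
  waveQueue := []
  waiting := False
  coins := fun _ => none
  decidedWave := 0
  deliveredVertices := ∅
  outputs := []

/-- The loop of `set_weak_edges`, from round `r` down to round `1`. -/
def setWeakEdges (D : Finset (Vertex f B)) : ℕ → Vertex f B → Vertex f B
  | 0, v => v
  | r + 1, v =>
    setWeakEdges D r { v with
      weakEdges := v.weakEdges ∪ ((layer D (r + 1)).filter fun u => ¬ Path D v u).image Vertex.ref }

/-- `create_new_vertex` for the current round, with the block `b`. -/
def createVertex (p : Proc f) (s : LocalState f B) (b : B) : Vertex f B :=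
  setWeakEdges s.dag (s.round - 2)
    { round := s.round
      source := p
      block := b
      strongEdges := (layer s.dag (s.round - 1)).image Vertex.ref
      weakEdges := ∅ }

/-- `get_wave_vertex_leader(w)`; `none` stands for `⊥`.  (The handlers of the signals
`wave_ready` run one after the other, hence in the handler for a wave the coin has already
returned its value for all earlier waves, and a repeated call would return the same value.) -/
def waveLeader (s : LocalState f B) (w : ℕ) : Option (Vertex f B) :=
  match s.coins w with
  | none => none
  | some j =>
    if h : ∃ v, v ∈ waveLayer s.dag w 1 ∧ v.source = j then some h.choose else none

/-- The loop that collects the leaders of the waves from `w'` down to `decidedWave + 1`, where `v`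
is the last leader pushed; the head of the list is the top of the stack. -/
def collectLeaders (s : LocalState f B) : ℕ → Vertex f B → List (Vertex f B) → List (Vertex f B)
  | 0, _, stack => stack
  | w' + 1, v, stack =>
    if w' + 1 ≤ s.decidedWave then stack
    else
      match waveLeader s (w' + 1) with
      | none => collectLeaders s w' v stack
      | some v' =>
        if StrongPath s.dag v v' then collectLeaders s w' v' (v' :: stack)
        else collectLeaders s w' v stack

/-- One iteration of `order_vertices`: deliver the causal history of the popped leader `v`. -/
def deliverHistory (P : Params f B) (s : LocalState f B) (v : Vertex f B) : LocalState f B :=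
  let S := s.dag.filter fun u => 1 ≤ u.round ∧ Path s.dag v u ∧ u ∉ s.deliveredVertices
  { s with
    outputs := s.outputs ++ (P.order S).map fun u => (u.block, u.round, u.source)
    deliveredVertices := s.deliveredVertices ∪ S }

/-- `order_vertices(leadersStack)`. -/
def orderVertices (P : Params f B) (s : LocalState f B) (stack : List (Vertex f B)) :
    LocalState f B :=
  stack.foldl (deliverHistory P) s

/-- The handler of `wave_ready(w)`, from the return of the coin on. -/
def waveReady (P : Params f B) (s : LocalState f B) (w : ℕ) : LocalState f B :=
  match waveLeader s w with
  | none => s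
  | some v =>
    if ((waveLayer s.dag w 4).filter fun v' => StrongPath s.dag v' v).card < 2 * f + 1 then s
    else orderVertices P { s with decidedWave := w } (collectLeaders s (w - 1) v [v])

/-- The actions of a process: inputs, outputs and internal steps. -/
inductive Action (f : ℕ) (B : Type*) where
  /-- `a_bcast(b, r)` -/
  | abcast (b : B) (r : ℕ)
  /-- `r_bcast(m, r)` -/
  | rbcast (m : Vertex f B) (r : ℕ)
  /-- `r_deliver(m, r, p_k)` -/
  | rdeliver (m : Vertex f B) (r : ℕ) (k : Proc f)
  /-- move a vertex from the buffer to the DAG -/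
  | addVertex (v : Vertex f B)
  /-- complete the current round and enter the next one -/
  | advance
  /-- call `choose_leader(w)` -/
  | chooseLeader (w : ℕ)
  /-- `choose_leader(w)` returns `l` -/
  | coinReturn (w : ℕ) (l : Proc f)

/-- When the code of `p` allows an action. -/
def Enabled (p : Proc f) (s : LocalState f B) : Action f B → Prop
  | .abcast _ r => r = s.seq + 1
  | .rbcast m r =>
    s.creating ∧ r = s.round ∧ ∃ b, s.blocksToPropose.head? = some b ∧ m = createVertex p s b
  | .rdeliver _ _ _ => True
  | .addVertex v =>
    v ∈ s.buffer ∧ v.round ≤ s.round ∧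
      ∀ e ∈ v.strongEdges ∪ v.weakEdges, ∃ u ∈ s.dag, u.ref = e
  | .advance => ¬ s.creating ∧ 2 * f + 1 ≤ (layer s.dag s.round).card
  | .chooseLeader w => s.waveQueue.head? = some w ∧ ¬ s.waiting
  | .coinReturn w _ => s.waveQueue.head? = some w ∧ s.waiting

/-- The effect of an action on the local state. -/
def applyAction (P : Params f B) (s : LocalState f B) : Action f B → LocalState f B
  | .abcast b _ => { s with seq := s.seq + 1, blocksToPropose := s.blocksToPropose ++ [b] }
  | .rbcast _ _ => { s with creating := False, blocksToPropose := s.blocksToPropose.tail }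
  | .rdeliver m r k =>
    let v : Vertex f B := { m with round := r, source := k }
    if v.WellFormed then { s with buffer := insert v s.buffer } else s
  | .addVertex v => { s with dag := insert v s.dag, buffer := s.buffer.erase v }
  | .advance =>
    { s with
      waveQueue := if s.round % 4 = 0 then s.waveQueue ++ [s.round / 4] else s.waveQueue
      round := s.round + 1
      creating := True }
  | .chooseLeader _ => { s with waiting := True }
  | .coinReturn w l =>
    waveReady P
      { s with
        coins := Function.update s.coins w (some l)
        waveQueue := s.waveQueue.tail
        waiting := False } w

/-! ## Runs -/

/-- The events of a run: an action of a process, the corruption of a process by the adversary, or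
an event that does not concern the protocol. -/
inductive Event (f : ℕ) (B : Type*) where
  | act (p : Proc f) (a : Action f B)
  | corrupt (p : Proc f)
  | idle

/-- The local state of `p` after an event (of interest only while `p` is not corrupted). -/
def applyEvent (P : Params f B) (p : Proc f) (s : LocalState f B) : Event f B → LocalState f B
  | .act q a => if q = p then applyAction P s a else s
  | .corrupt _ => s
  | .idle => s

/-- The local state of `p` just before event number `t`. -/
def stateAt (P : Params f B) (e : ℕ → Event f B) (p : Proc f) : ℕ → LocalState f B
  | 0 => initState P
  | t + 1 => applyEvent P p (stateAt P e p t) (e t)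

/-- `p` is corrupted before event number `t`. -/
def CorruptedBefore (e : ℕ → Event f B) (t : ℕ) (p : Proc f) : Prop :=
  ∃ t' < t, e t' = .corrupt p

/-- `p` is correct in the run: it is never corrupted. -/
def Correct (e : ℕ → Event f B) (p : Proc f) : Prop := ∀ t, e t ≠ .corrupt p

/-- The processes (Byzantine ones included) that call `choose_leader(w)` before event `t`. -/
def callers (e : ℕ → Event f B) (w t : ℕ) : Finset (Proc f) :=
  Finset.univ.filter fun p => ∃ t' < t, e t' = .act p (.chooseLeader w)

/-- `e` is a run of DAG-Rider: processes follow the code until they are corrupted, at most `f` are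
ever corrupted, every correct process keeps executing its code, and is given infinitely many
blocks to broadcast. -/
structure IsRun (P : Params f B) (e : ℕ → Event f B) : Prop where
  follows : ∀ t p a, e t = .act p a → ¬ CorruptedBefore e t p → Enabled p (stateAt P e p t) a
  budget : (Finset.univ.filter fun p => ¬ Correct e p).card ≤ f
  eventually_add : ∀ p, Correct e p → ∀ t v, Enabled p (stateAt P e p t) (.addVertex v) →
    ∃ t' ≥ t, e t' = .act p (.addVertex v)
  eventually_advance : ∀ p, Correct e p → ∀ t, Enabled p (stateAt P e p t) .advance →
    ∃ t' ≥ t, e t' = .act p .advance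
  eventually_rbcast : ∀ p, Correct e p → ∀ t m r, Enabled p (stateAt P e p t) (.rbcast m r) →
    ∃ t' ≥ t, ∃ m' r', e t' = .act p (.rbcast m' r')
  eventually_call : ∀ p, Correct e p → ∀ t w, Enabled p (stateAt P e p t) (.chooseLeader w) →
    ∃ t' ≥ t, e t' = .act p (.chooseLeader w)
  infinitely_many_abcast : ∀ p, Correct e p → ∀ t, ∃ t' ≥ t, ∃ b r, e t' = .act p (.abcast b r)

/-- `p` outputs `a_deliver(b, r, p_k)` at some point of the run. -/
def ADelivers (P : Params f B) (e : ℕ → Event f B) (p : Proc f) (b : B) (r : ℕ) (k : Proc f) :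
    Prop :=
  ∃ t, (b, r, k) ∈ (stateAt P e p t).outputs

/-! ## The building blocks -/

/-- The guarantees of reliable broadcast, for one run. -/
structure ReliableBroadcast (e : ℕ → Event f B) : Prop where
  agreement : ∀ p q, Correct e p → Correct e q → ∀ m r k,
    (∃ t, e t = .act p (.rdeliver m r k)) → ∃ t, e t = .act q (.rdeliver m r k)
  integrity : ∀ p, Correct e p → ∀ r k t t' m m',
    e t = .act p (.rdeliver m r k) → e t' = .act p (.rdeliver m' r k) → t = t'
  validity : ∀ p q, Correct e p → Correct e q → ∀ m r,
    (∃ t, e t = .act p (.rbcast m r)) → ∃ t, e t = .act q (.rdeliver m r p)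

/-- The guarantees of a global perfect coin in a random run.  `X w` is the leader that instance
`w` chooses, `ℱ t` the information available when event number `t` is scheduled, and `ε` the
advantage that the adversary may have in guessing a value that is not yet revealed. -/
structure PerfectCoin {Ω : Type*} {mΩ : MeasurableSpace Ω} (μ : Measure Ω)
    (ℱ : Filtration ℕ mΩ) (run : Ω → ℕ → Event f B) (X : ℕ → Ω → Proc f) (ε : ℝ) : Prop where
  measurable : ∀ w, Measurable (X w)
  agreement : ∀ᵐ ω ∂μ, ∀ t p w l, run ω t = .act p (.coinReturn w l) →
    ¬ CorruptedBefore (run ω) t p → l = X w ω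
  termination : ∀ᵐ ω ∂μ, ∀ w, (∃ t, f + 1 ≤ (callers (run ω) w t).card) →
    ∀ p, Correct (run ω) p → ∀ t, run ω t = .act p (.chooseLeader w) →
      ∃ t' > t, ∃ l, run ω t' = .act p (.coinReturn w l)
  unpredictability : ∀ w j t, ∀ᵐ ω ∂μ, (callers (run ω) w t).card < f + 1 →
    (μ[{ω' | X w ω' = j}.indicator (fun _ => (1 : ℝ)) | ℱ t]) ω ≤ μ.real {ω' | X w ω' = j} + ε
  fairness : ∀ w j, μ.real {ω | X w ω = j} = 1 / (3 * f + 1 : ℝ)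

end

end DagRider

namespace DagRider

open MeasureTheory
open scoped Classical

variable {f : ℕ} {B : Type*}

/-! Safety is quorum intersection. Reliable broadcast makes the DAGs of correct processes consistent
(`consistent_stateAt`), and every DAG contains the endpoints of its edges, so a vertex has the same
causal history in every DAG that contains it (`Path.transfer`). If a correct process commits the
leader `v` of wave `w`, then `2 f + 1` vertices of round `4 w` have strong paths to `v`. Any vertex
of round `4 w + 1` has a strong edge to one of them, so all later vertices in all correct DAGs have
strong paths to `v` (`strongPath_of_quorum`). A process that decides a later wave therefore meets
`v` on its way back through the leaders, and delivers its history (`IsRun.mem_deliveredVertices`).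
Since everything delivered lies in the history of a committed leader (`IsRun.exists_committed`),
agreement follows once every correct process decides arbitrarily late waves.

For liveness, the DAGs grow forever and all coins return (`IsRun.exists_le_round`,
`IsRun.exists_coinReturn`). Double counting gives a hub in the second round of each wave, and every
vertex of the fourth round has strong paths, through the hub, to the same `2 f + 1` or more vertices
of the first round: the core (`IsHub.exists_strongPath`). If the leader lies in the core, all
correct processes commit the wave (`IsRun.exists_decidedWave_eq`). Some correct process calls the
coin while at most `f` processes have called it. Its core is then fixed and the leader still
unpredictable, so the leader is in the core with conditional probability at least `δ > 0`, as at
most `f` processes are outside.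

The adversary is adaptive, so whether this caller will stay correct is unknown at the time of the
call. The probabilistic argument therefore fixes a process `p` and looks at all its early calls made
before corruption; by pigeonhole some correct `p` makes infinitely many. The events "first success
after wave `W`" are disjoint, so the probabilities of the attempts not preceded by a success sum to
at most `1 / δ`, and the first Borel–Cantelli lemma excludes infinitely many attempts without
success (`PerfectCoin.ae_exists_mem_core`). Independence of the waves is not needed. -/

/-! ## Combinatorics of DAGs -/

/-- The endpoints of all edges are present. -/
def Closed (D : Finset (Vertex f B)) : Prop :=
  ∀ v ∈ D, ∀ e ∈ v.strongEdges ∪ v.weakEdges, ∃ u ∈ D, u.ref = e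

/-- Two DAGs do not contain different vertices with the same round and source. -/
def Consistent (D D' : Finset (Vertex f B)) : Prop :=
  ∀ u ∈ D, ∀ v ∈ D', u.ref = v.ref → u = v

/-- The properties of the DAG of a process that follows the code. -/
structure IsDag (D : Finset (Vertex f B)) : Prop where
  closed : Closed D
  consistent : Consistent D D
  wellFormed : ∀ v ∈ D, v.round ≠ 0 → v.WellFormed

theorem ref_eq_iff {u v : Vertex f B} : u.ref = v.ref ↔ u.round = v.round ∧ u.source = v.source := by
  simp [Vertex.ref]

theorem mem_layer {D : Finset (Vertex f B)} {r : ℕ} {v : Vertex f B} :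
    v ∈ layer D r ↔ v ∈ D ∧ v.round = r := by simp [layer]

theorem Vertex.WellFormed.round_pos {v : Vertex f B} (h : v.WellFormed) : 1 ≤ v.round := by
  have : v.strongEdges.Nonempty := Finset.card_pos.mp (by have := h.1; omega)
  obtain ⟨e, he⟩ := this
  have := h.2.1 e he
  omega

/-- Two sets of processes of total size exceeding `3 f + 1` intersect. -/
theorem exists_mem_of_card_add {S T : Finset (Proc f)} (h : 3 * f + 1 < S.card + T.card) :
    ∃ k, k ∈ S ∧ k ∈ T := by
  obtain ⟨k, hk⟩ := Finset.inter_nonempty_of_card_lt_card_add_card (Finset.subset_univ S)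
    (Finset.subset_univ T) (by simpa using h)
  exact ⟨k, Finset.mem_inter.mp hk⟩

theorem card_image_source {D S : Finset (Vertex f B)} (hD : Consistent D D) {r : ℕ}
    (hS : ∀ v ∈ S, v ∈ D ∧ v.round = r) : (S.image Vertex.source).card = S.card := by
  refine Finset.card_image_of_injOn fun u hu v hv huv => hD u (hS u hu).1 v (hS v hv).1 ?_
  exact ref_eq_iff.mpr ⟨(hS u hu).2.trans (hS v hv).2.symm, huv⟩

/-- The sources of the endpoints of the strong edges of a vertex. -/
noncomputable def strongSources (x : Vertex f B) : Finset (Proc f) := x.strongEdges.image Prod.snd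

theorem mem_strongSources {x : Vertex f B} (hx : x.WellFormed) {r : ℕ} (hr : x.round = r + 1)
    {k : Proc f} : k ∈ strongSources x ↔ (r, k) ∈ x.strongEdges := by
  simp only [strongSources, Finset.mem_image]
  constructor
  · rintro ⟨e, he, rfl⟩
    have := hx.2.1 e he
    have : e.1 = r := by omega
    subst this
    exact he
  · intro h
    exact ⟨_, h, rfl⟩

theorem card_strongSources {x : Vertex f B} (hx : x.WellFormed) :
    2 * f + 1 ≤ (strongSources x).card := by
  rw [strongSources, Finset.card_image_of_injOn]
  · exact hx.1
  · intro e he e' he' h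
    have h1 := hx.2.1 e he
    have h2 := hx.2.1 e' he'
    exact Prod.ext (by omega) h

/-- Along the path, closedness of `D'` provides a vertex with the required reference, and
consistency identifies it with the one in `D`. Thus `D'` need not contain `D`. -/
theorem StrongPath.transfer {D D' : Finset (Vertex f B)} (hD' : Closed D') (h : Consistent D D')
    {v u : Vertex f B} (hv : v ∈ D') (hp : StrongPath D v u) : StrongPath D' v u ∧ u ∈ D' := by
  induction hp with
  | refl => exact ⟨.refl, hv⟩
  | @tail x u _ hxu ih =>
    obtain ⟨hu, hr, he⟩ := hxu
    obtain ⟨u', hu', hr'⟩ := hD' x ih.2 u.ref (Finset.mem_union_left _ he)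
    obtain rfl := h u hu u' hu' hr'.symm
    exact ⟨ih.1.tail ⟨hu', hr, he⟩, hu'⟩

theorem Path.transfer {D D' : Finset (Vertex f B)} (hD' : Closed D') (h : Consistent D D')
    {v u : Vertex f B} (hv : v ∈ D') (hp : Path D v u) : Path D' v u ∧ u ∈ D' := by
  induction hp with
  | refl => exact ⟨.refl, hv⟩
  | @tail x u _ hxu ih =>
    obtain ⟨hu, hr, he⟩ := hxu
    obtain ⟨u', hu', hr'⟩ := hD' x ih.2 u.ref (by rwa [Finset.union_comm])
    obtain rfl := h u hu u' hu' hr'.symm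
    exact ⟨ih.1.tail ⟨hu', hr, he⟩, hu'⟩

theorem StrongPath.path {D : Finset (Vertex f B)} {v u : Vertex f B} (h : StrongPath D v u) :
    Path D v u :=
  Relation.ReflTransGen.mono (fun _ _ h => ⟨h.1, h.2.1, Finset.mem_union_right _ h.2.2⟩) _ _ h

/-- A vertex of round `r + 1` to which at least `f + 1` vertices of round `r + 2` have strong
edges. -/
def IsHub (D : Finset (Vertex f B)) (r : ℕ) (x : Vertex f B) : Prop :=
  x ∈ D ∧ x.round = r + 1 ∧ f + 1 ≤ ((layer D (r + 2)).filter fun y => x.ref ∈ y.strongEdges).card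

/-- Double counting of strong edges from round `r + 2` to round `r + 1`: there are at least `(2 f +
1)²`, more than the `f (3 f + 1)` possible if each of the `3 f + 1` sources were referred to at most
`f` times. -/
theorem exists_isHub {D : Finset (Vertex f B)} (hD : IsDag D) {r : ℕ}
    (h : 2 * f + 1 ≤ (layer D (r + 2)).card) : ∃ x, IsHub D r x := by
  have hwf : ∀ y ∈ layer D (r + 2), y.WellFormed := fun y hy =>
    hD.wellFormed y (mem_layer.mp hy).1 (by rw [(mem_layer.mp hy).2]; omega)
  have hcount : ∃ k : Proc f,
      f + 1 ≤ ((layer D (r + 2)).filter fun y => (r + 1, k) ∈ y.strongEdges).card := by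
    by_contra! hlt
    have h1 : ∑ k : Proc f, ((layer D (r + 2)).filter fun y => k ∈ strongSources y).card
        = ∑ y ∈ layer D (r + 2), (Finset.univ.filter fun k => k ∈ strongSources y).card :=
      (Finset.sum_card_bipartiteAbove_eq_sum_card_bipartiteBelow fun y k =>
        k ∈ strongSources y).symm
    have h2 : ∑ k : Proc f, ((layer D (r + 2)).filter fun y => k ∈ strongSources y).card
        ≤ ∑ _k : Proc f, f := by
      refine Finset.sum_le_sum fun k _ => ?_
      have := hlt k
      rw [Finset.filter_congr fun y hy =>
        mem_strongSources (hwf y hy) (mem_layer.mp hy).2]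
      omega
    have h3 : ∑ _y ∈ layer D (r + 2), (2 * f + 1)
        ≤ ∑ y ∈ layer D (r + 2), (Finset.univ.filter fun k => k ∈ strongSources y).card := by
      refine Finset.sum_le_sum fun y hy => ?_
      simpa using card_strongSources (hwf y hy)
    simp only [Finset.sum_const, smul_eq_mul, Finset.card_univ, Fintype.card_fin] at h2 h3
    nlinarith
  obtain ⟨k, hk⟩ := hcount
  obtain ⟨y, hy⟩ := Finset.card_pos.mp (show 0 < _ by omega : 0 < ((layer D (r + 2)).filter
    fun y => (r + 1, k) ∈ y.strongEdges).card)
  rw [Finset.mem_filter, mem_layer] at hy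
  obtain ⟨x, hx, hxr⟩ := hD.closed y hy.1.1 _ (Finset.mem_union_left _ hy.2)
  refine ⟨x, hx, congrArg Prod.fst hxr, ?_⟩
  rwa [hxr]

/-- The common core: every vertex of round `r + 3` has strong paths to all the vertices of round
`r` that a hub refers to. -/
theorem IsHub.exists_strongPath {D D' : Finset (Vertex f B)} (hD : IsDag D) (hD' : IsDag D')
    (h : Consistent D D') {r : ℕ} (hr : 1 ≤ r) {x : Vertex f B} (hx : IsHub D r x)
    {z : Vertex f B} (hz : z ∈ D') (hzr : z.round = r + 3) {j : Proc f}
    (hj : j ∈ strongSources x) :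
    ∃ u ∈ D', u.round = r ∧ u.source = j ∧ StrongPath D' z u := by
  obtain ⟨hxD, hxr, hcard⟩ := hx
  have hxwf := hD.wellFormed x hxD (by omega)
  have hzwf := hD'.wellFormed z hz (by omega)
  rw [← card_image_source (r := r + 2) hD.consistent
    fun v hv => mem_layer.mp (Finset.mem_filter.mp hv).1] at hcard
  -- The `f + 1` vertices above the hub and the `2 f + 1` strong edges of `z` must share a source,
  -- since `(f + 1) + (2 f + 1) > 3 f + 1`. This gives the path from `z` over `y` and `x` to `u`.
  obtain ⟨k, hk1, hk2⟩ := exists_mem_of_card_add (f := f)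
    (lt_of_lt_of_le (by omega) (add_le_add hcard (card_strongSources hzwf)))
  obtain ⟨y, hy, rfl⟩ := Finset.mem_image.mp hk1
  rw [Finset.mem_filter, mem_layer] at hy
  obtain ⟨⟨hyD, hyr⟩, hxy⟩ := hy
  rw [mem_strongSources hzwf (r := r + 2) hzr] at hk2
  rw [mem_strongSources hxwf hxr] at hj
  obtain ⟨y', hy', hyy⟩ := hD'.closed z hz _ (Finset.mem_union_left _ hk2)
  obtain rfl : y = y' := h y hyD y' hy' (by rw [hyy, ← hyr]; rfl)
  obtain ⟨x', hx', hxx⟩ := hD'.closed y hy' _ (Finset.mem_union_left _ hxy)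
  obtain rfl : x = x' := h x hxD x' hx' hxx.symm
  obtain ⟨u, hu, hur⟩ := hD'.closed x hx' _ (Finset.mem_union_left _ hj)
  have hur1 : u.round = r := congrArg Prod.fst hur
  refine ⟨u, hu, hur1, congrArg Prod.snd hur, ?_⟩
  refine ((Relation.ReflTransGen.single ?_).tail (b := y) ?_).tail (b := x) ?_
  · exact ⟨hy', by omega, by rw [hyy]; exact hk2⟩
  · exact ⟨hx', by omega, hxy⟩
  · exact ⟨hu, by omega, by rw [hur]; exact hj⟩

/-- If `2 f + 1` vertices of round `r` have a strong path to `v`, then so has every vertex of a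
later round, in every consistent DAG. -/
theorem strongPath_of_quorum {D D' : Finset (Vertex f B)} (hD : IsDag D) (hD' : IsDag D')
    (h : Consistent D D') {r : ℕ} (hr : 1 ≤ r) {v : Vertex f B}
    (hq : 2 * f + 1 ≤ ((layer D r).filter fun z => StrongPath D z v).card) (z : Vertex f B)
    (hz : z ∈ D') (hzr : r < z.round) : StrongPath D' z v ∧ v ∈ D' := by
  obtain ⟨m, hm⟩ : ∃ m, z.round = r + 1 + m := ⟨z.round - (r + 1), by omega⟩
  induction m generalizing z with
  | zero =>
    have hzwf := hD'.wellFormed z hz (by omega)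
    rw [← card_image_source (r := r) hD.consistent
      fun v hv => mem_layer.mp (Finset.mem_filter.mp hv).1] at hq
    obtain ⟨k, hk1, hk2⟩ := exists_mem_of_card_add (f := f)
      (lt_of_lt_of_le (by omega) (add_le_add hq (card_strongSources hzwf)))
    obtain ⟨y, hy, rfl⟩ := Finset.mem_image.mp hk1
    rw [Finset.mem_filter, mem_layer] at hy
    obtain ⟨⟨hyD, hyr⟩, hyv⟩ := hy
    rw [mem_strongSources hzwf (r := r) hm] at hk2
    obtain ⟨y', hy', hyy⟩ := hD'.closed z hz _ (Finset.mem_union_left _ hk2)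
    obtain rfl : y = y' := h y hyD y' hy' (by rw [hyy, ← hyr]; rfl)
    obtain ⟨h1, h2⟩ := hyv.transfer hD'.closed h hy'
    exact ⟨.head ⟨hy', by omega, by rw [hyy]; exact hk2⟩ h1, h2⟩
  | succ m ih =>
    have hzwf := hD'.wellFormed z hz (by omega)
    obtain ⟨e, he⟩ := Finset.card_pos.mp (show 0 < z.strongEdges.card by have := hzwf.1; omega)
    obtain ⟨y, hy, hyr⟩ := hD'.closed z hz e (Finset.mem_union_left _ he)
    have h1 := hzwf.2.1 e he
    have h2 : y.round = e.1 := congrArg Prod.fst hyr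
    obtain ⟨h3, h4⟩ := ih y hy (by omega) (by omega)
    exact ⟨.head ⟨hy, by omega, by rw [hyr]; exact he⟩ h3, h4⟩

/-! ## The code of one process -/

theorem orderVertices_eq (P : Params f B) (s : LocalState f B) (stack : List (Vertex f B)) :
    ∃ V o, orderVertices P s stack = { s with deliveredVertices := V, outputs := o } := by
  induction stack generalizing s with
  | nil => exact ⟨_, _, rfl⟩
  | cons v stack ih =>
    obtain ⟨V, o, h⟩ := ih (deliverHistory P s v)
    exact ⟨V, o, h⟩

/-- Delivering a history changes neither the DAG nor its paths, so the delivered set does not depend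
on the order in which leaders are popped. -/
theorem mem_orderVertices {P : Params f B} {s : LocalState f B} {stack : List (Vertex f B)}
    {u : Vertex f B} : u ∈ (orderVertices P s stack).deliveredVertices ↔
      u ∈ s.deliveredVertices ∨ ∃ v ∈ stack, u ∈ s.dag ∧ 1 ≤ u.round ∧ Path s.dag v u := by
  induction stack generalizing s with
  | nil => simp [orderVertices]
  | cons v stack ih =>
    refine (ih (s := deliverHistory P s v)).trans ?_
    simp only [deliverHistory, Finset.mem_union, Finset.mem_filter, List.mem_cons,
      exists_eq_or_imp]
    tauto

/-- The handler of a wave either does nothing or commits the leader of the wave. -/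
theorem waveReady_cases (P : Params f B) (s : LocalState f B) (w : ℕ) :
    waveReady P s w = s ∨ ∃ v, waveLeader s w = some v ∧
      2 * f + 1 ≤ ((waveLayer s.dag w 4).filter fun v' => StrongPath s.dag v' v).card ∧
      waveReady P s w =
        orderVertices P { s with decidedWave := w } (collectLeaders s (w - 1) v [v]) := by
  unfold waveReady
  split
  · exact .inl rfl
  · rename_i v hv
    split
    · exact .inl rfl
    · exact .inr ⟨v, hv, by omega, rfl⟩

/-- The handler leaves the DAG, buffer, round, queues and coins alone; invariants about these
survive a return of the coin. -/
theorem waveReady_eq (P : Params f B) (s : LocalState f B) (w : ℕ) : ∃ d V o,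
    waveReady P s w = { s with decidedWave := d, deliveredVertices := V, outputs := o } := by
  obtain h | ⟨v, -, -, h⟩ := waveReady_cases P s w
  · exact ⟨_, _, _, h⟩
  · obtain ⟨V, o, h'⟩ := orderVertices_eq P { s with decidedWave := w }
      (collectLeaders s (w - 1) v [v])
    exact ⟨w, V, o, h.trans h'⟩

theorem deliveredVertices_subset_waveReady (P : Params f B) (s : LocalState f B) (w : ℕ) :
    s.deliveredVertices ⊆ (waveReady P s w).deliveredVertices := by
  obtain h | ⟨v, -, -, h⟩ := waveReady_cases P s w
  · rw [h]
  · rw [h]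
    exact fun u hu => mem_orderVertices.mpr (.inl hu)

theorem mem_waveLayer {D : Finset (Vertex f B)} {w k : ℕ} {v : Vertex f B} :
    v ∈ waveLayer D w k ↔ v ∈ D ∧ v.round + 4 = 4 * w + k := by simp [waveLayer]

theorem waveLayer_four (D : Finset (Vertex f B)) (w : ℕ) :
    waveLayer D w 4 = layer D (4 * w) := by
  ext v
  rw [mem_waveLayer, mem_layer]
  exact and_congr_right fun _ => by omega

theorem waveLeader_spec {s : LocalState f B} {w : ℕ} {v : Vertex f B}
    (h : waveLeader s w = some v) :
    v ∈ s.dag ∧ v.round + 4 = 4 * w + 1 ∧ s.coins w = some v.source := by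
  unfold waveLeader at h
  split at h
  · exact absurd h (by simp)
  · rename_i j hj
    split at h
    · rename_i hv
      obtain rfl := Option.some.inj h
      obtain ⟨h1, h2⟩ := hv.choose_spec
      rw [mem_waveLayer] at h1
      exact ⟨h1.1, h1.2, by rw [hj, h2]⟩
    · exact absurd h (by simp)

theorem waveLeader_eq_some {s : LocalState f B} (hs : Consistent s.dag s.dag) {w : ℕ}
    {v : Vertex f B} (hv : v ∈ s.dag) (hr : v.round + 4 = 4 * w + 1)
    (hc : s.coins w = some v.source) : waveLeader s w = some v := by
  have hex : ∃ u, u ∈ waveLayer s.dag w 1 ∧ u.source = v.source :=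
    ⟨v, mem_waveLayer.mpr ⟨hv, hr⟩, rfl⟩
  have h : waveLeader s w = some hex.choose := by
    unfold waveLeader
    rw [hc]
    exact dif_pos hex
  obtain ⟨h1, h2⟩ := hex.choose_spec
  rw [mem_waveLayer] at h1
  rw [h, hs _ h1.1 v hv (ref_eq_iff.mpr ⟨by omega, h2⟩)]

theorem subset_collectLeaders (s : LocalState f B) (n : ℕ) (v : Vertex f B)
    (stack : List (Vertex f B)) : stack ⊆ collectLeaders s n v stack := by
  induction n generalizing v stack with
  | zero => exact List.Subset.refl _
  | succ n ih =>
    unfold collectLeaders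
    split
    · exact List.Subset.refl _
    · split
      · exact ih _ _
      · split
        · exact fun x hx => ih _ _ (List.mem_cons_of_mem _ hx)
        · exact ih _ _

theorem strongPath_of_mem_collectLeaders {s : LocalState f B} {n : ℕ} {v x : Vertex f B}
    {stack : List (Vertex f B)} (hx : x ∈ collectLeaders s n v stack) :
    x ∈ stack ∨ StrongPath s.dag v x := by
  induction n generalizing v stack with
  | zero => exact .inl hx
  | succ n ih =>
    unfold collectLeaders at hx
    split at hx
    · exact .inl hx
    · split at hx
      · exact ih hx
      · split at hx
        · rename_i v' _ hv'
          obtain h | h := ih hx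
          · obtain rfl | h := List.mem_cons.mp h
            · exact .inr hv'
            · exact .inl h
          · exact .inr (Relation.ReflTransGen.trans hv' h)
        · exact ih hx

/-- A leader to which all vertices of the later waves have a strong path is collected. -/
theorem mem_collectLeaders {s : LocalState f B} {w : ℕ} {x : Vertex f B}
    (hx : waveLeader s w = some x) (hw : s.decidedWave < w)
    (hpath : ∀ z ∈ s.dag, 4 * w < z.round → StrongPath s.dag z x) {n : ℕ} (hn : w ≤ n)
    {v : Vertex f B} (hv : v ∈ s.dag) (hvr : 4 * w < v.round) (stack : List (Vertex f B)) :
    x ∈ collectLeaders s n v stack := by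
  induction n generalizing v stack with
  | zero => omega
  | succ n ih =>
    unfold collectLeaders
    rw [if_neg (by omega)]
    obtain rfl | hlt := hn.eq_or_lt
    · rw [hx]
      simp only [if_pos (hpath v hv hvr)]
      exact subset_collectLeaders _ _ _ _ List.mem_cons_self
    -- Every leader pushed before wave `w` is reached belongs to a later wave, hence to a round
    -- above `4 * w`, so the hypothesis on paths still applies to it.
    · split
      · exact ih (by omega) hv hvr _
      · rename_i v' hv'
        obtain ⟨h1, h2, -⟩ := waveLeader_spec hv'
        split
        · exact ih (by omega) h1 (by omega) _
        · exact ih (by omega) hv hvr _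

/-- Only the range of the weak edges matters for agreement, not which vertices they lead to. -/
theorem setWeakEdges_spec (D : Finset (Vertex f B)) (n : ℕ) (v : Vertex f B) :
    ∃ W, setWeakEdges D n v = { v with weakEdges := W } ∧
      ∀ e ∈ W, e ∈ v.weakEdges ∨ ∃ u ∈ D, u.ref = e ∧ 1 ≤ u.round ∧ u.round ≤ n := by
  induction n generalizing v with
  | zero => exact ⟨v.weakEdges, rfl, fun e he => .inl he⟩
  | succ n ih =>
    obtain ⟨W, h1, h2⟩ := ih { v with
      weakEdges := v.weakEdges ∪ ((layer D (n + 1)).filter fun u => ¬ Path D v u).image Vertex.ref }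
    refine ⟨W, h1, fun e he => ?_⟩
    obtain h | ⟨u, hu, hue, hu1, hun⟩ := h2 e he
    · obtain h | h := Finset.mem_union.mp h
      · exact .inl h
      · obtain ⟨u, hu, rfl⟩ := Finset.mem_image.mp h
        rw [Finset.mem_filter, mem_layer] at hu
        exact .inr ⟨u, hu.1.1, rfl, by omega, by omega⟩
    · exact .inr ⟨u, hu, hue, hu1, by omega⟩

theorem createVertex_spec (p : Proc f) (s : LocalState f B) (b : B) :
    ∃ W, createVertex p s b =
      { round := s.round, source := p, block := b,
        strongEdges := (layer s.dag (s.round - 1)).image Vertex.ref, weakEdges := W } ∧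
      ∀ e ∈ W, ∃ u ∈ s.dag, u.ref = e ∧ 1 ≤ u.round ∧ u.round ≤ s.round - 2 := by
  obtain ⟨W, h1, h2⟩ := setWeakEdges_spec s.dag (s.round - 2)
    { round := s.round, source := p, block := b,
      strongEdges := (layer s.dag (s.round - 1)).image Vertex.ref, weakEdges := ∅ }
  exact ⟨W, h1, fun e he => (h2 e he).resolve_left (by simp)⟩

/-- This ensures that vertices broadcast by correct processes pass the check on reception. -/
theorem createVertex_wellFormed {p : Proc f} {s : LocalState f B} {b : B} (hr : 1 ≤ s.round)
    (hs : Consistent s.dag s.dag) (hcard : 2 * f + 1 ≤ (layer s.dag (s.round - 1)).card) :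
    (createVertex p s b).WellFormed := by
  obtain ⟨W, h1, h2⟩ := createVertex_spec p s b
  rw [h1]
  refine ⟨?_, fun e he => ?_, fun e he => ?_⟩
  · rw [Finset.card_image_of_injOn]
    · exact hcard
    · intro u hu v hv huv
      exact hs u (mem_layer.mp hu).1 v (mem_layer.mp hv).1 huv
  · obtain ⟨u, hu, rfl⟩ := Finset.mem_image.mp he
    have := (mem_layer.mp hu).2
    show u.round + 1 = s.round
    omega
  · obtain ⟨u, hu, rfl, h3, h4⟩ := h2 e he
    show u.round + 1 < s.round
    omega

theorem exists_ref_of_mem_createVertex {p : Proc f} {s : LocalState f B} {b : B} {e : Ref f}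
    (he : e ∈ (createVertex p s b).strongEdges ∪ (createVertex p s b).weakEdges) :
    ∃ u ∈ s.dag, u.ref = e := by
  obtain ⟨W, h1, h2⟩ := createVertex_spec p s b
  rw [h1] at he
  obtain he | he := Finset.mem_union.mp he
  · obtain ⟨u, hu, rfl⟩ := Finset.mem_image.mp he
    exact ⟨u, (mem_layer.mp hu).1, rfl⟩
  · obtain ⟨u, hu, rfl, -⟩ := h2 e he
    exact ⟨u, hu, rfl⟩

/-! ### Invariants and monotonicity of the local state -/

/-- The invariants of the code, as far as they concern one process alone. -/
structure CodeInvariant (P : Params f B) (s : LocalState f B) : Prop where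
  closed : Closed s.dag
  genesis_subset : P.genesis ⊆ s.dag
  dag_cases : ∀ v ∈ s.dag, v ∈ P.genesis ∨ v.WellFormed
  buffer_wellFormed : ∀ v ∈ s.buffer, v.WellFormed
  layer_card : ∀ r < s.round, 2 * f + 1 ≤ (layer s.dag r).card
  round_pos : s.creating → 1 ≤ s.round
  -- Here `a` is the first wave whose coin has not returned. The waves signalled so far are the
  -- multiples of 4 below the current round, divided by 4, and their number is `(s.round + 3) / 4`;
  -- wave 0 is among them.
  waves : ∃ a b, s.waveQueue = List.range' a b ∧ a + b = (s.round + 3) / 4 ∧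
    ∀ w, s.coins w = none ↔ a ≤ w
  mem_outputs : ∀ o, o ∈ s.outputs ↔ ∃ u ∈ s.deliveredVertices, o = (u.block, u.round, u.source)

theorem codeInvariant_init (P : Params f B) : CodeInvariant P (initState P) where
  closed v hv e he := by
    obtain ⟨h1, h2⟩ := P.genesis_edges v hv
    simp [h1, h2] at he
  genesis_subset := Finset.Subset.refl _
  dag_cases v hv := .inl hv
  buffer_wellFormed v hv := by simp [initState] at hv
  layer_card r hr := by simp [initState] at hr
  round_pos h := h.elim
  waves := ⟨0, 0, rfl, by simp [initState], fun w => by simp [initState]⟩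
  mem_outputs o := by simp [initState]

theorem mem_outputs_orderVertices {P : Params f B} {s : LocalState f B}
    (h : ∀ o, o ∈ s.outputs ↔ ∃ u ∈ s.deliveredVertices, o = (u.block, u.round, u.source))
    (stack : List (Vertex f B)) (o : B × ℕ × Proc f) :
    o ∈ (orderVertices P s stack).outputs ↔
      ∃ u ∈ (orderVertices P s stack).deliveredVertices, o = (u.block, u.round, u.source) := by
  induction stack generalizing s with
  | nil => exact h o
  | cons v stack ih =>
    refine ih (s := deliverHistory P s v) fun o => ?_
    have hmem : ∀ (S : Finset (Vertex f B)) u, u ∈ P.order S ↔ u ∈ S := fun S u => by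
      rw [← Finset.mem_val, ← P.order_spec S, Multiset.mem_coe]
    simp only [deliverHistory, List.mem_append, List.mem_map, h, hmem, Finset.mem_union,
      or_and_right, exists_or, eq_comm (a := o)]

theorem mem_outputs_waveReady {P : Params f B} {s : LocalState f B}
    (h : ∀ o, o ∈ s.outputs ↔ ∃ u ∈ s.deliveredVertices, o = (u.block, u.round, u.source))
    (w : ℕ) (o : B × ℕ × Proc f) : o ∈ (waveReady P s w).outputs ↔
      ∃ u ∈ (waveReady P s w).deliveredVertices, o = (u.block, u.round, u.source) := by
  obtain h' | ⟨v, -, -, h'⟩ := waveReady_cases P s w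
  · rw [h']
    exact h o
  · rw [h']
    exact mem_outputs_orderVertices (s := { s with decidedWave := w }) h _ o

theorem layer_mono {D D' : Finset (Vertex f B)} (h : D ⊆ D') (r : ℕ) : layer D r ⊆ layer D' r :=
  Finset.filter_subset_filter _ h

theorem codeInvariant_step {P : Params f B} {p : Proc f} {s : LocalState f B}
    (hs : CodeInvariant P s) {a : Action f B} (ha : Enabled p s a) :
    CodeInvariant P (applyAction P s a) := by
  obtain ⟨h1, h2, h3, h4, h5, h6, h7, h8⟩ := hs
  cases a with
  | abcast b r => exact ⟨h1, h2, h3, h4, h5, h6, h7, h8⟩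
  | rbcast m r => exact ⟨h1, h2, h3, h4, h5, fun h => h.elim, h7, h8⟩
  | rdeliver m r k =>
    simp only [applyAction]
    split
    · rename_i hwf
      refine ⟨h1, h2, h3, fun v hv => ?_, h5, h6, h7, h8⟩
      obtain rfl | hv := Finset.mem_insert.mp hv
      · exact hwf
      · exact h4 v hv
    · exact ⟨h1, h2, h3, h4, h5, h6, h7, h8⟩
  | addVertex v =>
    obtain ⟨hv, hvr, hve⟩ := ha
    refine ⟨fun x hx e he => ?_, h2.trans (Finset.subset_insert _ _), fun x hx => ?_,
      fun x hx => h4 x (Finset.mem_of_mem_erase hx),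
      fun r hr => (h5 r hr).trans (Finset.card_le_card (layer_mono (Finset.subset_insert _ _) r)),
      h6, h7, h8⟩
    · obtain ⟨u, hu, hue⟩ : ∃ u ∈ s.dag, u.ref = e := by
        obtain rfl | hx := Finset.mem_insert.mp hx
        · exact hve e he
        · exact h1 x hx e he
      exact ⟨u, Finset.mem_insert_of_mem hu, hue⟩
    · obtain rfl | hx := Finset.mem_insert.mp hx
      · exact .inr (h4 x hv)
      · exact h3 x hx
  | advance =>
    refine ⟨h1, h2, h3, h4, fun r hr => ?_, fun _ => Nat.le_add_left 1 s.round, ?_, h8⟩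
    · obtain hr | rfl := Nat.lt_succ_iff_lt_or_eq.mp hr
      · exact h5 r hr
      · exact ha.2
    · obtain ⟨a, b, hq, hab, hc⟩ := h7
      simp only [applyAction]
      split
      · refine ⟨a, b + 1, ?_, by omega, hc⟩
        rw [hq, List.range'_concat]
        congr 2
        omega
      · exact ⟨a, b, hq, by omega, hc⟩
  | chooseLeader w => exact ⟨h1, h2, h3, h4, h5, h6, h7, h8⟩
  | coinReturn w l =>
    obtain ⟨a, b, hq, hab, hc⟩ := h7
    have hout := mem_outputs_waveReady (P := P)
      (s := { s with
        coins := Function.update s.coins w (some l), waveQueue := s.waveQueue.tail,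
        waiting := False }) h8 w
    simp only [applyAction]
    obtain ⟨d, V, o, h⟩ := waveReady_eq P
      { s with
        coins := Function.update s.coins w (some l), waveQueue := s.waveQueue.tail,
        waiting := False } w
    rw [h] at hout ⊢
    refine ⟨h1, h2, h3, h4, h5, h6, ?_, hout⟩
    have hhead := ha.1
    rw [hq] at hhead
    cases b with
    | zero => simp at hhead
    | succ b =>
      rw [List.range'_succ, List.head?_cons] at hhead
      obtain rfl := Option.some.inj hhead
      refine ⟨a + 1, b, by simp only [hq, List.range'_succ, List.tail_cons], by dsimp only; omega, fun w => ?_⟩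
      by_cases hw : w = a
      · subst hw
        simp
      · simp only [Function.update_of_ne hw, hc]
        omega

theorem CodeInvariant.of_head {P : Params f B} {s : LocalState f B} (hs : CodeInvariant P s)
    {w : ℕ} (hw : s.waveQueue.head? = some w) :
    4 * w < s.round ∧ ∀ w', s.coins w' = none ↔ w ≤ w' := by
  obtain ⟨a, b, hq, hab, hc⟩ := hs.waves
  rw [hq] at hw
  cases b with
  | zero => simp at hw
  | succ b =>
    rw [List.range'_succ, List.head?_cons] at hw
    obtain rfl := Option.some.inj hw
    exact ⟨by omega, hc⟩

/-- What only grows during the execution of the code. -/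
structure Grows (s s' : LocalState f B) : Prop where
  dag : s.dag ⊆ s'.dag
  -- A vertex leaves the buffer only by entering the DAG.
  buffer : s.buffer ⊆ s'.buffer ∪ s'.dag
  round : s.round ≤ s'.round
  coins : ∀ w, s'.coins w = none → s.coins w = none
  deliveredVertices : s.deliveredVertices ⊆ s'.deliveredVertices

theorem Grows.refl (s : LocalState f B) : Grows s s :=
  ⟨Finset.Subset.refl _, Finset.subset_union_left, le_rfl, fun _ h => h, Finset.Subset.refl _⟩

theorem Grows.trans {s s' s'' : LocalState f B} (h : Grows s s') (h' : Grows s' s'') :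
    Grows s s'' :=
  ⟨h.dag.trans h'.dag,
    h.buffer.trans (Finset.union_subset h'.buffer (h'.dag.trans Finset.subset_union_right)),
    h.round.trans h'.round, fun w hw => h.coins w (h'.coins w hw),
    h.deliveredVertices.trans h'.deliveredVertices⟩

theorem grows_applyAction (P : Params f B) (s : LocalState f B) (a : Action f B) :
    Grows s (applyAction P s a) := by
  obtain ⟨h1, h2, h3, h4, h5⟩ := Grows.refl s
  cases a with
  | abcast b r => exact ⟨h1, h2, h3, h4, h5⟩
  | rbcast m r => exact ⟨h1, h2, h3, h4, h5⟩
  | rdeliver m r k =>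
    simp only [applyAction]
    split
    · exact ⟨h1, (Finset.subset_insert _ _).trans Finset.subset_union_left, h3, h4, h5⟩
    · exact ⟨h1, h2, h3, h4, h5⟩
  | addVertex v =>
    refine ⟨Finset.subset_insert _ _, fun x hx => ?_, h3, h4, h5⟩
    by_cases hxv : x = v
    · subst hxv
      exact Finset.mem_union_right _ (Finset.mem_insert_self _ _)
    · exact Finset.mem_union_left _ (Finset.mem_erase.mpr ⟨hxv, hx⟩)
  | advance => exact ⟨h1, h2, Nat.le_succ _, h4, h5⟩
  | chooseLeader w => exact ⟨h1, h2, h3, h4, h5⟩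
  | coinReturn w l =>
    have hdel := deliveredVertices_subset_waveReady P
      { s with
        coins := Function.update s.coins w (some l), waveQueue := s.waveQueue.tail,
        waiting := False } w
    simp only [applyAction]
    obtain ⟨d, V, o, h⟩ := waveReady_eq P
      { s with
        coins := Function.update s.coins w (some l), waveQueue := s.waveQueue.tail,
        waiting := False } w
    rw [h] at hdel ⊢
    refine ⟨h1, h2, h3, fun w' hw' => ?_, hdel⟩
    by_cases hw : w' = w
    · subst hw
      simp at hw'
    · simpa [Function.update_of_ne hw] using hw'

/-! ## Runs -/

section Runs

variable {P : Params f B} {e : ℕ → Event f B} {p q : Proc f} {t t' : ℕ}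

theorem stateAt_succ_of_act {a : Action f B} (h : e t = .act p a) :
    stateAt P e p (t + 1) = applyAction P (stateAt P e p t) a := by
  simp [stateAt, applyEvent, h]

theorem stateAt_succ_cases (P : Params f B) (e : ℕ → Event f B) (p : Proc f) (t : ℕ) :
    stateAt P e p (t + 1) = stateAt P e p t ∨
      ∃ a, e t = .act p a ∧ stateAt P e p (t + 1) = applyAction P (stateAt P e p t) a := by
  cases h : e t with
  | act q a =>
    by_cases hq : q = p
    · subst hq
      exact .inr ⟨a, rfl, stateAt_succ_of_act h⟩
    · exact .inl (by simp [stateAt, applyEvent, h, hq])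
  | corrupt q => exact .inl (by simp [stateAt, applyEvent, h])
  | idle => exact .inl (by simp [stateAt, applyEvent, h])

theorem grows_stateAt (P : Params f B) (e : ℕ → Event f B) (p : Proc f) (h : t ≤ t') :
    Grows (stateAt P e p t) (stateAt P e p t') := by
  induction t', h using Nat.le_induction with
  | base => exact Grows.refl _
  | succ t' _ ih =>
    refine ih.trans ?_
    obtain h | ⟨a, -, h⟩ := stateAt_succ_cases P e p t'
    · rw [h]
      exact Grows.refl _
    · rw [h]
      exact grows_applyAction _ _ _

theorem Correct.not_corruptedBefore (hp : Correct e p) (t : ℕ) : ¬ CorruptedBefore e t p :=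
  fun ⟨t', _, h⟩ => hp t' h

theorem CorruptedBefore.mono (h : CorruptedBefore e t p) (htt : t ≤ t') :
    CorruptedBefore e t' p :=
  let ⟨s, hs, h⟩ := h
  ⟨s, hs.trans_le htt, h⟩

theorem IsRun.codeInvariant (hrun : IsRun P e) :
    ∀ t, ¬ CorruptedBefore e t p → CodeInvariant P (stateAt P e p t)
  | 0, _ => codeInvariant_init P
  | t + 1, hc => by
    have hc' : ¬ CorruptedBefore e t p := fun h => hc (h.mono (Nat.le_succ t))
    have ih := hrun.codeInvariant t hc'
    obtain h | ⟨a, ha, h⟩ := stateAt_succ_cases P e p t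
    · rwa [h]
    · rw [h]
      exact codeInvariant_step ih (hrun.follows t p a ha hc')

/-- `p` outputs `r_deliver` for the vertex `v`. -/
def Received (e : ℕ → Event f B) (p : Proc f) (v : Vertex f B) : Prop :=
  ∃ t m, e t = .act p (.rdeliver m v.round v.source) ∧
    { m with round := v.round, source := v.source } = v

theorem IsRun.received (hrun : IsRun P e) (hp : Correct e p) (t : ℕ) :
    (∀ v ∈ (stateAt P e p t).buffer, Received e p v) ∧
      ∀ v ∈ (stateAt P e p t).dag, v ∈ P.genesis ∨ Received e p v := by
  induction t with
  | zero => exact ⟨fun v hv => by simp [stateAt, initState] at hv, fun v hv => .inl hv⟩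
  | succ t ih =>
    obtain h | ⟨a, ha, h⟩ := stateAt_succ_cases P e p t
    · rwa [h]
    rw [h]
    have hen := hrun.follows t p a ha (hp.not_corruptedBefore t)
    cases a with
    | abcast b r => exact ih
    | rbcast m r => exact ih
    | advance => exact ih
    | chooseLeader w => exact ih
    | rdeliver m r k =>
      simp only [applyAction]
      split
      · refine ⟨fun v hv => ?_, ih.2⟩
        obtain rfl | hv := Finset.mem_insert.mp hv
        · exact ⟨t, m, ha, rfl⟩
        · exact ih.1 v hv
      · exact ih
    | addVertex u =>
      refine ⟨fun v hv => ih.1 v (Finset.mem_of_mem_erase hv), fun v hv => ?_⟩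
      obtain rfl | hv := Finset.mem_insert.mp hv
      · exact .inr (ih.1 v hen.1)
      · exact ih.2 v hv
    | coinReturn w l =>
      simp only [applyAction]
      obtain ⟨d, V, o, h⟩ := waveReady_eq P
        { stateAt P e p t with
          coins := Function.update (stateAt P e p t).coins w (some l)
          waveQueue := (stateAt P e p t).waveQueue.tail
          waiting := False } w
      rw [h]
      exact ih

theorem Received.transfer (hrb : ReliableBroadcast e) (hp : Correct e p) (hq : Correct e q)
    {v : Vertex f B} (h : Received e p v) : Received e q v := by
  obtain ⟨t, m, ht, hm⟩ := h
  obtain ⟨t', ht'⟩ := hrb.agreement p q hp hq m _ _ ⟨t, ht⟩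
  exact ⟨t', m, ht', hm⟩

/-- Integrity forces the two deliveries for the same round and source to be the same event, hence
the same message. -/
theorem Received.eq (hrb : ReliableBroadcast e) (hp : Correct e p) {u v : Vertex f B}
    (hu : Received e p u) (hv : Received e p v) (huv : u.ref = v.ref) : u = v := by
  obtain ⟨t, m, ht, hm⟩ := hu
  obtain ⟨t', m', ht', hm'⟩ := hv
  obtain ⟨hr, hs⟩ := ref_eq_iff.mp huv
  rw [hr, hs] at ht hm
  obtain rfl := hrb.integrity p hp _ _ t t' m m' ht ht'
  rw [ht] at ht'
  simp only [Event.act.injEq, Action.rdeliver.injEq, true_and, and_true] at ht'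
  rw [← hm, ← hm', ht']

/-- Agreement and integrity of the broadcast handle received vertices. Genesis vertices have round 0
and distinct sources, and well-formed ones have positive round, so the two kinds cannot share a
reference. -/
theorem consistent_stateAt (hrun : IsRun P e) (hrb : ReliableBroadcast e) (hp : Correct e p)
    (hq : Correct e q) (t t' : ℕ) :
    Consistent (stateAt P e p t).dag (stateAt P e q t').dag := by
  intro u hu v hv huv
  have hround := (ref_eq_iff.mp huv).1
  have key : ∀ {p t v}, Correct e p → v ∈ (stateAt P e p t).dag →
      (v ∈ P.genesis ∧ v.round = 0) ∨ (Received e p v ∧ (v ∈ P.genesis ∨ 1 ≤ v.round)) := by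
    intro p t v hp hv
    obtain h | h := (hrun.received hp t).2 v hv
    · exact .inl ⟨h, P.genesis_round v h⟩
    · refine .inr ⟨h, ?_⟩
      exact ((hrun.codeInvariant t (hp.not_corruptedBefore t)).dag_cases v hv).imp_right
        fun h => h.round_pos
  have gen : u ∈ P.genesis → v ∈ P.genesis → u = v := fun hu hv =>
    P.genesis_source u hu v hv (ref_eq_iff.mp huv).2
  obtain ⟨h1, h2⟩ | ⟨h1, h2⟩ := key hp hu <;> obtain ⟨h3, h4⟩ | ⟨h3, h4⟩ := key hq hv
  · exact gen h1 h3
  · exact gen h1 (h4.resolve_right (by omega))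
  · exact gen (h2.resolve_right (by omega)) h3
  · exact (h1.transfer hrb hp hq).eq hrb hq h3 huv

theorem isDag_stateAt (hrun : IsRun P e) (hrb : ReliableBroadcast e) (hp : Correct e p) (t : ℕ) :
    IsDag (stateAt P e p t).dag where
  closed := (hrun.codeInvariant t (hp.not_corruptedBefore t)).closed
  consistent := consistent_stateAt hrun hrb hp hp t t
  wellFormed v hv hr :=
    ((hrun.codeInvariant t (hp.not_corruptedBefore t)).dag_cases v hv).resolve_left
      fun h => hr (P.genesis_round v h)

/-! ## Liveness of the construction of the DAG -/

theorem eventually_mem_dag {v : Vertex f B} (h : v ∈ (stateAt P e p t).dag) :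
    ∀ᶠ t' in Filter.atTop, v ∈ (stateAt P e p t').dag :=
  Filter.eventually_atTop.mpr ⟨t, fun _ h' => (grows_stateAt P e p h').dag h⟩

theorem eventually_le_round {r : ℕ} (h : r ≤ (stateAt P e p t).round) :
    ∀ᶠ t' in Filter.atTop, r ≤ (stateAt P e p t').round :=
  Filter.eventually_atTop.mpr ⟨t, fun _ h' => h.trans (grows_stateAt P e p h').round⟩

/-- Rounds and DAGs only grow, so all conditions for adding the vertex hold together from some time
on, and fairness applies. -/
theorem IsRun.eventually_mem_of_mem_buffer (hrun : IsRun P e) (hp : Correct e p) {v : Vertex f B}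
    (hv : v ∈ (stateAt P e p t).buffer)
    (hr : ∃ t, v.round ≤ (stateAt P e p t).round)
    (he : ∀ x ∈ v.strongEdges ∪ v.weakEdges,
      ∀ᶠ t in Filter.atTop, ∃ u ∈ (stateAt P e p t).dag, u.ref = x) :
    ∀ᶠ t in Filter.atTop, v ∈ (stateAt P e p t).dag := by
  obtain ⟨t₁, ht₁⟩ := hr
  obtain ⟨T, ⟨hT1, hT2⟩, hT3⟩ := (((Filter.eventually_all_finset _).mpr he).and
    (eventually_le_round ht₁)).and (Filter.eventually_ge_atTop t) |>.exists
  obtain h | h := Finset.mem_union.mp ((grows_stateAt P e p hT3).buffer hv)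
  · obtain ⟨t₂, -, ht₂⟩ := hrun.eventually_add p hp T v ⟨h, hT2, hT1⟩
    refine eventually_mem_dag (t := t₂ + 1) ?_
    rw [stateAt_succ_of_act ht₂]
    exact Finset.mem_insert_self _ _
  · exact eventually_mem_dag h

theorem Received.exists_mem_buffer {v : Vertex f B} (h : Received e p v) (hv : v.WellFormed) :
    ∃ t, v ∈ (stateAt P e p t).buffer := by
  obtain ⟨t, m, ht, hm⟩ := h
  refine ⟨t + 1, ?_⟩
  rw [stateAt_succ_of_act ht]
  simp only [applyAction, hm, if_pos hv]
  exact Finset.mem_insert_self _ _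

theorem Vertex.WellFormed.lt_round {v : Vertex f B} (h : v.WellFormed) {x : Ref f}
    (hx : x ∈ v.strongEdges ∪ v.weakEdges) : x.1 < v.round := by
  obtain hx | hx := Finset.mem_union.mp hx
  · have := h.2.1 x hx
    omega
  · have := h.2.2 x hx
    omega

/-- A vertex in the DAG of a correct process gets into the DAG of every correct process that
reaches its round. -/
theorem IsRun.eventually_mem_dag_of_mem (hrun : IsRun P e) (hrb : ReliableBroadcast e)
    (hp : Correct e p) (hq : Correct e q) {v : Vertex f B} (hv : v ∈ (stateAt P e p t).dag)
    (hr : ∃ t, v.round ≤ (stateAt P e q t).round) :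
    ∀ᶠ t in Filter.atTop, v ∈ (stateAt P e q t).dag := by
  induction hn : v.round using Nat.strong_induction_on generalizing v with
  | _ n ih =>
    subst hn
    have hinv := hrun.codeInvariant t (hp.not_corruptedBefore t)
    have hgen : v ∈ P.genesis → ∀ᶠ t in Filter.atTop, v ∈ (stateAt P e q t).dag := fun h =>
      .of_forall fun t => (hrun.codeInvariant t (hq.not_corruptedBefore t)).genesis_subset h
    obtain h | hrec := (hrun.received hp t).2 v hv
    · exact hgen h
    obtain h | hwf := hinv.dag_cases v hv
    · exact hgen h
    obtain ⟨t₁, ht₁⟩ := (hrec.transfer hrb hp hq).exists_mem_buffer (P := P) hwf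
    refine hrun.eventually_mem_of_mem_buffer hq ht₁ hr fun x hx => ?_
    obtain ⟨u, hu, rfl⟩ := hinv.closed v hv x hx
    have hlt : u.round < v.round := hwf.lt_round hx
    refine (ih u.round hlt hu ?_ rfl).mono fun t h => ⟨u, h, rfl⟩
    obtain ⟨t₂, ht₂⟩ := hr
    exact ⟨t₂, hlt.le.trans ht₂⟩

theorem stateAt_succ_round_creating (h : ¬ ∃ m r, e t = .act p (.rbcast m r))
    (h' : e t ≠ .act p .advance) :
    (stateAt P e p (t + 1)).round = (stateAt P e p t).round ∧
      (stateAt P e p (t + 1)).creating = (stateAt P e p t).creating := by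
  obtain hs | ⟨a, ha, hs⟩ := stateAt_succ_cases P e p t
  · rw [hs]
    exact ⟨rfl, rfl⟩
  rw [hs]
  cases a with
  | abcast b r => exact ⟨rfl, rfl⟩
  | rbcast m r => exact absurd ⟨m, r, ha⟩ h
  | advance => exact absurd ha h'
  | chooseLeader w => exact ⟨rfl, rfl⟩
  | rdeliver m r k =>
    simp only [applyAction]
    split <;> exact ⟨rfl, rfl⟩
  | addVertex u => exact ⟨rfl, rfl⟩
  | coinReturn w l =>
    simp only [applyAction]
    obtain ⟨d, V, o, h⟩ := waveReady_eq P
      { stateAt P e p t with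
        coins := Function.update (stateAt P e p t).coins w (some l)
        waveQueue := (stateAt P e p t).waveQueue.tail
        waiting := False } w
    rw [h]
    exact ⟨rfl, rfl⟩

theorem stateAt_succ_of_advance (h : e t = .act p .advance) :
    (stateAt P e p (t + 1)).round = (stateAt P e p t).round + 1 ∧
      (stateAt P e p (t + 1)).creating := by
  rw [stateAt_succ_of_act h]
  exact ⟨rfl, trivial⟩

theorem stateAt_succ_of_rbcast {m : Vertex f B} {r : ℕ} (h : e t = .act p (.rbcast m r)) :
    (stateAt P e p (t + 1)).round = (stateAt P e p t).round ∧
      ¬ (stateAt P e p (t + 1)).creating := by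
  rw [stateAt_succ_of_act h]
  exact ⟨rfl, id⟩

/-- A correct process that reaches round `r ≥ 1` broadcasts a vertex of round `r`. -/
theorem IsRun.exists_rbcast (hrun : IsRun P e) (hp : Correct e p) {r : ℕ} (hr : 1 ≤ r)
    (hreach : ∃ t, r ≤ (stateAt P e p t).round) :
    ∃ t b, (stateAt P e p t).round = r ∧
      e t = .act p (.rbcast (createVertex p (stateAt P e p t) b) r) := by
  -- The first moment at which the round is at least `r` comes right after an `advance`. This raises
  -- the round by exactly one, so the round equals `r` and the vertex is still to be created.
  obtain ⟨t, ht1, ht2⟩ : ∃ t, (stateAt P e p t).round = r ∧ (stateAt P e p t).creating := by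
    have hmin := fun t => Nat.find_min hreach (m := t)
    have hspec := Nat.find_spec hreach
    cases hT : Nat.find hreach with
    | zero =>
      rw [hT] at hspec
      simp [stateAt, initState] at hspec
      omega
    | succ T =>
      rw [hT] at hspec
      have hlt := hmin T (by omega)
      have hadv : e T = .act p .advance := by
        by_contra hne
        by_cases hrb : ∃ m r, e T = .act p (.rbcast m r)
        · obtain ⟨m, r', h⟩ := hrb
          have := (stateAt_succ_of_rbcast (P := P) h).1
          omega
        · have := (stateAt_succ_round_creating (P := P) hrb hne).1
          omega
      have := stateAt_succ_of_advance (P := P) hadv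
      exact ⟨T + 1, by omega, this.2⟩
  -- Without a broadcast the process stays in its round, because `advance` is disabled while
  -- `creating` holds. The next `a_bcast` makes the queue non-empty, and fairness then forces a
  -- broadcast.
  have hex : ∃ n, ∃ m r, e (t + n) = .act p (.rbcast m r) := by
    by_contra! hno
    have hstay : ∀ n, (stateAt P e p (t + n)).round = r ∧ (stateAt P e p (t + n)).creating := by
      intro n
      induction n with
      | zero => exact ⟨ht1, ht2⟩
      | succ n ih =>
        have := stateAt_succ_round_creating (P := P) (p := p) (e := e) (t := t + n)
          (fun ⟨m, r, h⟩ => hno n m r h)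
          fun h => (hrun.follows _ _ _ h (hp.not_corruptedBefore _)).1 ih.2
        rw [← add_assoc, this.1, this.2]
        exact ih
    obtain ⟨t₁, ht₁, b, r', hb⟩ := hrun.infinitely_many_abcast p hp t
    obtain ⟨b', hb'⟩ : ∃ b', (stateAt P e p (t₁ + 1)).blocksToPropose.head? = some b' := by
      rw [stateAt_succ_of_act hb]
      simp only [applyAction]
      cases (stateAt P e p t₁).blocksToPropose <;> simp
    obtain ⟨n, hn⟩ := Nat.exists_eq_add_of_le (ht₁.trans (Nat.le_succ t₁))
    rw [Nat.succ_eq_add_one] at hn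
    rw [hn] at hb'
    obtain ⟨t₂, ht₂, m, r₂, h⟩ := hrun.eventually_rbcast p hp (t + n) _ _
      ⟨(hstay n).2, rfl, b', hb', rfl⟩
    obtain ⟨n₂, rfl⟩ := Nat.exists_eq_add_of_le ((Nat.le_add_right t n).trans ht₂)
    exact hno n₂ m r₂ h
  have hstay : ∀ n ≤ Nat.find hex,
      (stateAt P e p (t + n)).round = r ∧ (stateAt P e p (t + n)).creating := by
    intro n hn
    induction n with
    | zero => exact ⟨ht1, ht2⟩
    | succ n ih =>
      have ih := ih (by omega)
      have := stateAt_succ_round_creating (P := P) (p := p) (e := e) (t := t + n)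
        (Nat.find_min hex (m := n) (by omega))
        fun h => (hrun.follows _ _ _ h (hp.not_corruptedBefore _)).1 ih.2
      rw [← add_assoc, this.1, this.2]
      exact ih
  obtain ⟨m, r', h⟩ := Nat.find_spec hex
  have hround := (hstay _ le_rfl).1
  obtain ⟨-, rfl, b, -, rfl⟩ := hrun.follows _ _ _ h (hp.not_corruptedBefore _)
  exact ⟨_, b, hround, by rw [h, hround]⟩

theorem IsRun.card_correct (hrun : IsRun P e) :
    2 * f + 1 ≤ (Finset.univ.filter fun p => Correct e p).card := by
  have h := hrun.budget
  have := Finset.card_filter_add_card_filter_not (s := (Finset.univ : Finset (Proc f)))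
    fun p => Correct e p
  rw [Finset.card_univ, Fintype.card_fin] at this
  omega

/-- Each of the at least `2 f + 1` correct processes broadcasts a vertex of round `r`. It reaches
the buffer of `q`, and the endpoints of its edges, present in the DAG of its creator, reach the DAG
of `q`. -/
theorem IsRun.eventually_layer_card (hrun : IsRun P e) (hrb : ReliableBroadcast e) {r : ℕ}
    (hreach : ∀ p, Correct e p → ∃ t, r ≤ (stateAt P e p t).round) (hq : Correct e q) :
    ∀ᶠ t in Filter.atTop, 2 * f + 1 ≤ (layer (stateAt P e q t).dag r).card := by
  rcases Nat.eq_zero_or_pos r with rfl | hr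
  · refine .of_forall fun t => P.genesis_card ▸ Finset.card_le_card fun v hv => ?_
    exact mem_layer.mpr ⟨(hrun.codeInvariant t (hq.not_corruptedBefore t)).genesis_subset hv,
      P.genesis_round v hv⟩
  have key : ∀ p ∈ Finset.univ.filter fun p => Correct e p, ∀ᶠ t in Filter.atTop,
      p ∈ (layer (stateAt P e q t).dag r).image Vertex.source := by
    intro p hp
    have hp : Correct e p := by simpa using hp
    obtain ⟨t, b, hround, hb⟩ := hrun.exists_rbcast hp hr (hreach p hp)
    have hinv := hrun.codeInvariant t (hp.not_corruptedBefore t)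
    have hwf : (createVertex p (stateAt P e p t) b).WellFormed :=
      createVertex_wellFormed (by omega) (consistent_stateAt hrun hrb hp hp t t)
        (hinv.layer_card _ (by omega))
    obtain ⟨W, hW, -⟩ := createVertex_spec p (stateAt P e p t) b
    have hvr : (createVertex p (stateAt P e p t) b).round = r := by rw [hW]; exact hround
    have hvs : (createVertex p (stateAt P e p t) b).source = p := by rw [hW]
    obtain ⟨t₁, ht₁⟩ := hrb.validity p q hp hq _ _ ⟨t, hb⟩
    have hrec : Received e q (createVertex p (stateAt P e p t) b) :=
      ⟨t₁, _, by rw [hvr, hvs]; exact ht₁, rfl⟩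
    obtain ⟨t₂, ht₂⟩ := hrec.exists_mem_buffer (P := P) hwf
    have hmem := hrun.eventually_mem_of_mem_buffer hq ht₂ (by rw [hvr]; exact hreach q hq)
      fun x hx => by
        obtain ⟨u, hu, rfl⟩ := exists_ref_of_mem_createVertex hx
        have hlt : u.round < r := hvr ▸ hwf.lt_round hx
        obtain ⟨t₃, ht₃⟩ := hreach q hq
        exact (hrun.eventually_mem_dag_of_mem hrb hp hq hu ⟨t₃, hlt.le.trans ht₃⟩).mono
          fun t h => ⟨u, h, rfl⟩
    exact hmem.mono fun t h => Finset.mem_image.mpr ⟨_, mem_layer.mpr ⟨h, hvr⟩, hvs⟩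
  refine ((Filter.eventually_all_finset _).mpr key).mono fun t ht => ?_
  exact hrun.card_correct.trans ((Finset.card_le_card ht).trans Finset.card_image_le)

/-- Every correct process reaches every round. -/
theorem IsRun.exists_le_round (hrun : IsRun P e) (hrb : ReliableBroadcast e) (r : ℕ) :
    ∀ p, Correct e p → ∃ t, r ≤ (stateAt P e p t).round := by
  induction r with
  | zero => exact fun p _ => ⟨0, Nat.zero_le _⟩
  | succ r ih =>
    intro p hp
    by_contra! hlt
    -- A process that never gets past round `r` eventually has broadcast its vertex and remains
    -- there with `creating` false. Once its layer is large enough `advance` is enabled, and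
    -- fairness contradicts being stuck.
    obtain ⟨t, hround, hcr⟩ : ∃ t, (stateAt P e p t).round = r ∧ ¬ (stateAt P e p t).creating := by
      rcases Nat.eq_zero_or_pos r with rfl | hr
      · exact ⟨0, rfl, id⟩
      · obtain ⟨t, b, ht, hb⟩ := hrun.exists_rbcast hp hr (ih p hp)
        have := stateAt_succ_of_rbcast (P := P) hb
        exact ⟨t + 1, by omega, this.2⟩
    have hstay : ∀ t' ≥ t, (stateAt P e p t').round = r ∧ ¬ (stateAt P e p t').creating := by
      intro t' ht'
      induction t', ht' using Nat.le_induction with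
      | base => exact ⟨hround, hcr⟩
      | succ t' _ iht =>
        have hnadv : e t' ≠ .act p .advance := fun h => by
          have := (stateAt_succ_of_advance (P := P) h).1
          have := hlt (t' + 1)
          omega
        by_cases hb : ∃ m r, e t' = .act p (.rbcast m r)
        · obtain ⟨m, r', h⟩ := hb
          have := stateAt_succ_of_rbcast (P := P) h
          exact ⟨by omega, this.2⟩
        · have := stateAt_succ_round_creating (P := P) hb hnadv
          rw [this.1, this.2]
          exact iht
    obtain ⟨T, hT1, hT2⟩ := ((hrun.eventually_layer_card hrb ih hp).and
      (Filter.eventually_ge_atTop t)).exists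
    obtain ⟨hr, hc⟩ := hstay T hT2
    obtain ⟨t', ht', hadv⟩ := hrun.eventually_advance p hp T ⟨hc, by rwa [hr]⟩
    have := (stateAt_succ_of_advance (P := P) hadv).1
    have := hlt (t' + 1)
    have := (hstay t' (by omega)).1
    omega

end Runs

section Waves

variable {P : Params f B} {e : ℕ → Event f B} {p q : Proc f} {t t' : ℕ}

/-! ## The waves -/

theorem coins_waveReady (P : Params f B) (s : LocalState f B) (w : ℕ) :
    (waveReady P s w).coins = s.coins := by
  obtain ⟨d, V, o, h⟩ := waveReady_eq P s w
  rw [h]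

theorem coins_applyAction {s : LocalState f B} {a : Action f B} {w : ℕ} {l : Proc f}
    (h : (applyAction P s a).coins w = some l) : s.coins w = some l ∨ a = .coinReturn w l := by
  cases a with
  | rdeliver m r k =>
    simp only [applyAction] at h
    split at h <;> exact .inl h
  | coinReturn w' l' =>
    simp only [applyAction, coins_waveReady] at h
    by_cases hw : w = w'
    · subst hw
      rw [Function.update_self] at h
      exact .inr (by rw [Option.some.inj h])
    · rw [Function.update_of_ne hw] at h
      exact .inl h
  | _ => exact .inl h

/-- The values that a process holds are those that the coin has chosen. -/
theorem coins_stateAt {X : ℕ → Proc f}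
    (hcoin : ∀ t p w l, e t = .act p (.coinReturn w l) → ¬ CorruptedBefore e t p → l = X w)
    (hc : ¬ CorruptedBefore e t p) {w : ℕ} {l : Proc f}
    (h : (stateAt P e p t).coins w = some l) : l = X w := by
  induction t with
  | zero => simp [stateAt, initState] at h
  | succ t ih =>
    have hc' : ¬ CorruptedBefore e t p := fun h => hc (h.mono (Nat.le_succ t))
    obtain hs | ⟨a, ha, hs⟩ := stateAt_succ_cases P e p t
    · exact ih hc' (hs ▸ h)
    · rw [hs] at h
      obtain h | rfl := coins_applyAction h
      · exact ih hc' h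
      · exact hcoin t p w l ha hc'

/-- The coin is called before it is waited for and before it returns. -/
theorem IsRun.called (hrun : IsRun P e) (hp : Correct e p) (t : ℕ) :
    ((stateAt P e p t).waiting → ∃ w, (stateAt P e p t).waveQueue.head? = some w ∧
      ∃ t, e t = .act p (.chooseLeader w)) ∧
    ∀ w, (stateAt P e p t).coins w ≠ none → ∃ t, e t = .act p (.chooseLeader w) := by
  induction t with
  | zero => exact ⟨fun h => h.elim, fun w h => absurd rfl h⟩
  | succ t ih =>
    obtain h | ⟨a, ha, h⟩ := stateAt_succ_cases P e p t
    · rwa [h]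
    rw [h]
    have hen := hrun.follows t p a ha (hp.not_corruptedBefore t)
    cases a with
    | abcast b r => exact ih
    | rbcast m r => exact ih
    | addVertex u => exact ih
    | advance =>
      refine ⟨fun hw => ?_, ih.2⟩
      obtain ⟨w, h1, h2⟩ := ih.1 hw
      refine ⟨w, ?_, h2⟩
      simp only [applyAction]
      split
      · rw [List.head?_append, h1]
        rfl
      · exact h1
    | chooseLeader w => exact ⟨fun _ => ⟨w, hen.1, t, ha⟩, ih.2⟩
    | rdeliver m r k =>
      simp only [applyAction]
      split <;> exact ih
    | coinReturn w l =>
      obtain ⟨w', h1, h2⟩ := ih.1 hen.2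
      obtain rfl := Option.some.inj (h1.symm.trans hen.1)
      refine ⟨fun hw => ?_, fun w hw => ?_⟩
      · simp only [applyAction] at hw
        obtain ⟨d, V, o, h⟩ := waveReady_eq P
          { stateAt P e p t with
            coins := Function.update (stateAt P e p t).coins w' (some l)
            waveQueue := (stateAt P e p t).waveQueue.tail
            waiting := False } w'
        rw [h] at hw
        exact hw.elim
      · obtain ⟨l', hl'⟩ := Option.ne_none_iff_exists'.mp hw
        obtain hc | hc := coins_applyAction hl'
        · exact ih.2 w (by simp [hc])
        · obtain ⟨rfl, -⟩ := Action.coinReturn.inj hc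
          exact h2

theorem mem_callers {w : ℕ} : p ∈ callers e w t ↔ ∃ s < t, e s = .act p (.chooseLeader w) := by
  simp [callers]

theorem IsRun.exists_card_callers (hrun : IsRun P e) {w : ℕ}
    (h : ∀ p, Correct e p → ∃ t, e t = .act p (.chooseLeader w)) :
    ∃ t, f + 1 ≤ (callers e w t).card := by
  have key : ∀ p ∈ Finset.univ.filter fun p => Correct e p, ∀ᶠ t in Filter.atTop,
      p ∈ callers e w t := fun p hp => by
    obtain ⟨t, ht⟩ := h p (by simpa using hp)
    filter_upwards [Filter.eventually_gt_atTop t] with t' ht'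
    exact mem_callers.mpr ⟨t, ht', ht⟩
  obtain ⟨t, ht⟩ := ((Filter.eventually_all_finset _).mpr key).exists
  have := hrun.card_correct.trans (Finset.card_le_card ht)
  exact ⟨t, by omega⟩

/-- Every correct process calls every instance of the coin, which returns. -/
theorem IsRun.exists_coinReturn (hrun : IsRun P e) (hrb : ReliableBroadcast e)
    (hterm : ∀ w, (∃ t, f + 1 ≤ (callers e w t).card) →
      ∀ p, Correct e p → ∀ t, e t = .act p (.chooseLeader w) →
        ∃ t' > t, ∃ l, e t' = .act p (.coinReturn w l)) (w : ℕ) :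
    ∀ p, Correct e p → (∃ t, e t = .act p (.chooseLeader w)) ∧
      ∃ t l, e t = .act p (.coinReturn w l) := by
  induction w using Nat.strong_induction_on with
  | _ w ih =>
    have hcall : ∀ p, Correct e p → ∃ t, e t = .act p (.chooseLeader w) := by
      intro p hp
      have h1 : ∀ w' ∈ Finset.range w, ∀ᶠ t in Filter.atTop, (stateAt P e p t).coins w' ≠ none := by
        intro w' hw'
        obtain ⟨-, t, l, ht⟩ := ih w' (Finset.mem_range.mp hw') p hp
        filter_upwards [Filter.eventually_ge_atTop (t + 1)] with t' ht' hnone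
        have := (grows_stateAt P e p ht').coins w' hnone
        rw [stateAt_succ_of_act ht] at this
        simp [applyAction, coins_waveReady] at this
      obtain ⟨t₀, ht₀⟩ := hrun.exists_le_round hrb (4 * w + 1) p hp
      obtain ⟨t, ht, hround⟩ := (((Filter.eventually_all_finset _).mpr h1).and
        (eventually_le_round ht₀)).exists
      by_cases hc : (stateAt P e p t).coins w = none
      · obtain ⟨a, b, hq, hab, hcoins⟩ := (hrun.codeInvariant t (hp.not_corruptedBefore t)).waves
        have haw : a ≤ w := (hcoins w).mp hc
        -- The coins of all earlier waves have returned, so a wave without a returned value that is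
        -- at most `w` can only be `w`.
        obtain rfl : a = w := by
          by_contra hne
          exact ht a (Finset.mem_range.mpr (by omega)) ((hcoins a).mpr le_rfl)
        have hhead : (stateAt P e p t).waveQueue.head? = some a := by
          obtain ⟨b, rfl⟩ : ∃ b', b = b' + 1 := ⟨b - 1, by omega⟩
          rw [hq, List.range'_succ, List.head?_cons]
        by_cases hwait : (stateAt P e p t).waiting
        · obtain ⟨w', h2, h3⟩ := (hrun.called hp t).1 hwait
          obtain rfl := Option.some.inj (h2.symm.trans hhead)
          exact h3
        · obtain ⟨t', -, ht'⟩ := hrun.eventually_call p hp t a ⟨hhead, hwait⟩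
          exact ⟨t', ht'⟩
      · exact (hrun.called hp t).2 w hc
    intro p hp
    obtain ⟨t, ht⟩ := hcall p hp
    obtain ⟨t', -, l, h⟩ := hterm w (hrun.exists_card_callers hcall) p hp t ht
    exact ⟨⟨t, ht⟩, t', l, h⟩

/-! ### Early calls of the coin and the core of a wave -/

/-- At time `t`, the process `p`, not yet corrupted, calls `choose_leader(w)` for the first time,
and at most `f` processes have called `choose_leader(w)` before. -/
def EarlyCall (e : ℕ → Event f B) (p : Proc f) (w t : ℕ) : Prop :=
  e t = .act p (.chooseLeader w) ∧ (∀ s < t, e s ≠ .act p (.chooseLeader w)) ∧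
    ¬ CorruptedBefore e t p ∧ (callers e w t).card < f + 1

/-- Every wave has an early call by a correct process. -/
theorem IsRun.exists_earlyCall (hrun : IsRun P e) {w : ℕ}
    (hcall : ∃ t, f + 1 ≤ (callers e w t).card) : ∃ p, Correct e p ∧ ∃ t, EarlyCall e p w t := by
  -- At the first time with `f + 1` callers one of them is correct, and its first call came strictly
  -- earlier, when there were at most `f`.
  have hspec := Nat.find_spec hcall
  obtain ⟨p, hp, hpc⟩ : ∃ p ∈ callers e w (Nat.find hcall), Correct e p := by
    by_contra! hno
    have := (Finset.card_le_card (fun p hp => by simpa using hno p hp :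
      callers e w (Nat.find hcall) ⊆ Finset.univ.filter fun p => ¬ Correct e p)).trans hrun.budget
    omega
  obtain ⟨t, ht, hpt⟩ := mem_callers.mp hp
  have hex : ∃ t, e t = .act p (.chooseLeader w) := ⟨t, hpt⟩
  refine ⟨p, hpc, Nat.find hex, Nat.find_spec hex, fun s hs => Nat.find_min hex hs,
    hpc.not_corruptedBefore _, ?_⟩
  have := Nat.find_min hcall (m := Nat.find hex) ((Nat.find_min' hex hpt).trans_lt ht)
  omega

/-- The sources of the vertices to which a hub in the second round of wave `w` refers. -/
noncomputable def core (D : Finset (Vertex f B)) (w : ℕ) : Finset (Proc f) :=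
  if h : ∃ x, IsHub D (4 * w - 3) x then strongSources h.choose else ∅

theorem exists_isHub_core {D : Finset (Vertex f B)} (hD : IsDag D) {w : ℕ} (hw : 1 ≤ w)
    (h : 2 * f + 1 ≤ (layer D (4 * w - 1)).card) :
    ∃ x, IsHub D (4 * w - 3) x ∧ core D w = strongSources x := by
  have hex : ∃ x, IsHub D (4 * w - 3) x :=
    exists_isHub hD (by rwa [show 4 * w - 3 + 2 = 4 * w - 1 by omega])
  exact ⟨hex.choose, hex.choose_spec, dif_pos hex⟩

theorem EarlyCall.codeInvariant (hrun : IsRun P e) {w : ℕ} (h : EarlyCall e p w t) :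
    CodeInvariant P (stateAt P e p t) ∧ (stateAt P e p t).waveQueue.head? = some w :=
  ⟨hrun.codeInvariant t h.2.2.1, (hrun.follows t p _ h.1 h.2.2.1).1⟩

theorem EarlyCall.coins_eq_none_iff (hrun : IsRun P e) {w : ℕ} (h : EarlyCall e p w t) {w' : ℕ} :
    (stateAt P e p t).coins w' = none ↔ w ≤ w' :=
  ((h.codeInvariant hrun).1.of_head (h.codeInvariant hrun).2).2 w'

/-- Handlers run one after the other: at the call for `w` the coin of `w'` has already returned,
while at the call for `w'` it has not. -/
theorem EarlyCall.lt (hrun : IsRun P e) {w w' : ℕ} (h : EarlyCall e p w t)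
    (h' : EarlyCall e p w' t') (hw : w' < w) : t' < t := by
  by_contra! htt
  have := (grows_stateAt P e p htt).coins w' ((h'.coins_eq_none_iff hrun).mpr le_rfl)
  rw [h.coins_eq_none_iff hrun] at this
  omega

theorem decidedWave_orderVertices (P : Params f B) (s : LocalState f B)
    (stack : List (Vertex f B)) : (orderVertices P s stack).decidedWave = s.decidedWave := by
  obtain ⟨V, o, h⟩ := orderVertices_eq P s stack
  rw [h]

/-- If the leader of a wave is in the core of a correct process, then every correct process
commits that wave. -/
theorem IsRun.exists_decidedWave_eq (hrun : IsRun P e) (hrb : ReliableBroadcast e)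
    {X : ℕ → Proc f}
    (hcoin : ∀ t p w l, e t = .act p (.coinReturn w l) → ¬ CorruptedBefore e t p → l = X w)
    (hp : Correct e p) (hq : Correct e q) {w : ℕ} (hw : 1 ≤ w) (hcall : EarlyCall e p w t)
    (hX : X w ∈ core (stateAt P e p t).dag w)
    (hret : ∃ t l, e t = .act q (.coinReturn w l)) :
    ∃ t, (stateAt P e q t).decidedWave = w := by
  have hD := isDag_stateAt hrun hrb hp t
  obtain ⟨hinv, hhead⟩ := hcall.codeInvariant hrun
  have hround := (hinv.of_head hhead).1
  obtain ⟨x, hx, hcore⟩ := exists_isHub_core hD hw (hinv.layer_card _ (by omega))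
  rw [hcore] at hX
  obtain ⟨t', l, ht'⟩ := hret
  have hD' := isDag_stateAt hrun hrb hq t'
  have hcons := consistent_stateAt hrun hrb hp hq t t'
  have hinv' := hrun.codeInvariant t' (hq.not_corruptedBefore t')
  have hround' := (hinv'.of_head (hrun.follows t' q _ ht' (hq.not_corruptedBefore t')).1).1
  have hcard := hinv'.layer_card _ hround'
  have hl := hcoin t' q w l ht' (hq.not_corruptedBefore t')
  subst hl
  -- Rounds `4 * w - 3` to `4 * w` form the wave. Every vertex of the last round in the DAG of `q`
  -- thus has a strong path to the vertex of the first round with source `X w`.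
  have hall := fun z (hz : z ∈ layer (stateAt P e q t').dag (4 * w)) =>
    hx.exists_strongPath hD hD' hcons (by omega) (mem_layer.mp hz).1
      (by have := (mem_layer.mp hz).2; omega) hX
  obtain ⟨z, hz⟩ := Finset.card_pos.mp (show 0 < _ by omega :
    0 < (layer (stateAt P e q t').dag (4 * w)).card)
  obtain ⟨u, hu, hur, hus, -⟩ := hall z hz
  refine ⟨t' + 1, ?_⟩
  rw [stateAt_succ_of_act ht']
  simp only [applyAction]
  set s : LocalState f B := { stateAt P e q t' with
    coins := Function.update (stateAt P e q t').coins w (some (X w))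
    waveQueue := (stateAt P e q t').waveQueue.tail
    waiting := False } with hs
  have hlead : waveLeader s w = some u :=
    waveLeader_eq_some (s := s) hD'.consistent hu (by omega) (by simp [hs, hus])
  have hle : ¬ ((waveLayer s.dag w 4).filter fun v' => StrongPath s.dag v' u).card < 2 * f + 1 := by
    rw [waveLayer_four, Finset.filter_true_of_mem]
    · exact not_lt.mpr hcard
    · intro z hz
      obtain ⟨u', hu', hur', hus', hpath⟩ := hall z hz
      obtain rfl := hD'.consistent u hu u' hu' (ref_eq_iff.mpr ⟨by omega, hus.trans hus'.symm⟩)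
      exact hpath
  simp only [waveReady, hlead, if_neg hle, decidedWave_orderVertices]

/-! ## Committed leaders and delivered vertices -/

/-- `v` is the leader vertex of wave `w`, and a correct process finds `2 f + 1` vertices of the
last round of the wave with a strong path to it. -/
def Committed (P : Params f B) (e : ℕ → Event f B) (X : ℕ → Proc f) (w : ℕ) (v : Vertex f B) :
    Prop :=
  ∃ p t, Correct e p ∧ v ∈ (stateAt P e p t).dag ∧ v.round + 4 = 4 * w + 1 ∧ v.source = X w ∧
    2 * f + 1 ≤ ((layer (stateAt P e p t).dag (4 * w)).filter fun z =>
      StrongPath (stateAt P e p t).dag z v).card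

theorem Committed.strongPath (hrun : IsRun P e) (hrb : ReliableBroadcast e) {X : ℕ → Proc f}
    {w : ℕ} {v : Vertex f B} (h : Committed P e X w v) (hq : Correct e q) {z : Vertex f B}
    (hz : z ∈ (stateAt P e q t).dag) (hr : 4 * w < z.round) :
    StrongPath (stateAt P e q t).dag z v ∧ v ∈ (stateAt P e q t).dag := by
  obtain ⟨p, t', hp, hv, hvr, -, hcard⟩ := h
  exact strongPath_of_quorum (isDag_stateAt hrun hrb hp t') (isDag_stateAt hrun hrb hq t)
    (consistent_stateAt hrun hrb hp hq t' t) (by omega) hcard z hz hr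

theorem applyAction_deliveredVertices {s : LocalState f B} {a : Action f B}
    (h : ∀ w l, a ≠ .coinReturn w l) :
    (applyAction P s a).deliveredVertices = s.deliveredVertices ∧
      (applyAction P s a).decidedWave = s.decidedWave := by
  cases a with
  | rdeliver m r k =>
    simp only [applyAction]
    split <;> exact ⟨rfl, rfl⟩
  | coinReturn w l => exact absurd rfl (h w l)
  | _ => exact ⟨rfl, rfl⟩

/-- How an event affects the delivered vertices of a correct process: either not at all, or a wave
is committed. -/
theorem IsRun.stateAt_succ_delivered (hrun : IsRun P e) {X : ℕ → Proc f}
    (hcoin : ∀ t p w l, e t = .act p (.coinReturn w l) → ¬ CorruptedBefore e t p → l = X w)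
    (hp : Correct e p) (t : ℕ) :
    ((stateAt P e p (t + 1)).deliveredVertices = (stateAt P e p t).deliveredVertices ∧
      (stateAt P e p (t + 1)).decidedWave = (stateAt P e p t).decidedWave) ∨
    ∃ (w : ℕ) (v : Vertex f B) (s : LocalState f B), Committed P e X w v ∧
      s.dag = (stateAt P e p t).dag ∧ s.decidedWave = (stateAt P e p t).decidedWave ∧
      s.deliveredVertices = (stateAt P e p t).deliveredVertices ∧
      (∀ w' ≤ w, s.coins w' = some (X w')) ∧ v ∈ s.dag ∧
      stateAt P e p (t + 1) =
        orderVertices P { s with decidedWave := w } (collectLeaders s (w - 1) v [v]) := by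
  obtain h | ⟨a, ha, h⟩ := stateAt_succ_cases P e p t
  · exact .inl (by simp [h])
  by_cases hret : ∃ w l, a = .coinReturn w l
  · obtain ⟨w, l, rfl⟩ := hret
    have hc := hp.not_corruptedBefore t
    have hcoins := ((hrun.codeInvariant t hc).of_head (hrun.follows t p _ ha hc).1).2
    obtain rfl := hcoin t p w l ha hc
    rw [h]
    simp only [applyAction]
    set s : LocalState f B := { stateAt P e p t with
      coins := Function.update (stateAt P e p t).coins w (some (X w))
      waveQueue := (stateAt P e p t).waveQueue.tail
      waiting := False } with hs
    obtain h' | ⟨v, hv, hcard, h'⟩ := waveReady_cases P s w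
    · rw [h']
      exact .inl ⟨rfl, rfl⟩
    · obtain ⟨hvm, hvr, hvs⟩ := waveLeader_spec hv
      have hsw : s.coins w = some (X w) := by simp [hs]
      refine .inr ⟨w, v, s, ⟨p, t, hp, hvm, hvr, ?_, ?_⟩, rfl, rfl, rfl, fun w' hw' => ?_, hvm, h'⟩
      · exact Option.some.inj (hvs.symm.trans hsw)
      · rwa [waveLayer_four] at hcard
      -- The coins of earlier waves have returned to this process, and by agreement of the coin
      -- their values are those of `X`.
      · obtain hlt | rfl := hw'.lt_or_eq
        · simp only [hs, Function.update_of_ne hlt.ne]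
          obtain ⟨l, hl⟩ := Option.ne_none_iff_exists'.mp
            (fun h => by have := (hcoins w').mp h; omega :
              (stateAt P e p t).coins w' ≠ none)
          rw [hl, coins_stateAt hcoin hc hl]
        · exact hsw
  · rw [h]
    exact .inl (applyAction_deliveredVertices fun w l h => hret ⟨w, l, h⟩)

/-- A delivered vertex is in the causal history of a committed leader. -/
theorem IsRun.exists_committed (hrun : IsRun P e) {X : ℕ → Proc f}
    (hcoin : ∀ t p w l, e t = .act p (.coinReturn w l) → ¬ CorruptedBefore e t p → l = X w)
    (hp : Correct e p) {u : Vertex f B} (hu : u ∈ (stateAt P e p t).deliveredVertices) :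
    1 ≤ u.round ∧ ∃ w v, Committed P e X w v ∧ ∃ t, Path (stateAt P e p t).dag v u := by
  induction t with
  | zero => simp [stateAt, initState] at hu
  | succ t ih =>
    obtain h | ⟨w, v, s, hv, h1, -, h3, -, -, h⟩ := hrun.stateAt_succ_delivered hcoin hp t
    · exact ih (h.1 ▸ hu)
    · rw [h, mem_orderVertices] at hu
      obtain hu | ⟨x, hx, -, hur, hxu⟩ := hu
      · exact ih (h3 ▸ hu)
      · refine ⟨hur, w, v, hv, t, ?_⟩
        rw [← h1]
        obtain hx | hx := strongPath_of_mem_collectLeaders hx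
        · rwa [← List.mem_singleton.mp hx]
        · exact Relation.ReflTransGen.trans hx.path hxu

/-- Once wave `w` is decided, the causal history of a committed leader of wave `w` is delivered. -/
theorem IsRun.mem_deliveredVertices (hrun : IsRun P e) (hrb : ReliableBroadcast e)
    {X : ℕ → Proc f}
    (hcoin : ∀ t p w l, e t = .act p (.coinReturn w l) → ¬ CorruptedBefore e t p → l = X w)
    (hp : Correct e p) (hq : Correct e q) {w : ℕ} {v u : Vertex f B} (hv : Committed P e X w v)
    (hpath : Path (stateAt P e p t').dag v u) (hur : 1 ≤ u.round)
    (ht : w ≤ (stateAt P e q t).decidedWave) : u ∈ (stateAt P e q t).deliveredVertices := by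
  have hw : 1 ≤ w := by
    obtain ⟨_, _, _, _, h, -⟩ := hv
    omega
  induction t with
  | zero =>
    simp [stateAt, initState] at ht
    omega
  | succ t ih =>
    by_cases hlt : w ≤ (stateAt P e q t).decidedWave
    · exact (grows_stateAt P e q (Nat.le_succ t)).deliveredVertices (ih hlt)
    obtain h | ⟨w₂, v₂, s, hv₂, h1, h2, h3, h4, hmem, h⟩ := hrun.stateAt_succ_delivered hcoin hq t
    · exact absurd (h.2 ▸ ht) hlt
    rw [h, decidedWave_orderVertices] at ht
    have hcons := consistent_stateAt hrun hrb hp hq t' t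
    have hD := isDag_stateAt hrun hrb hq t
    suffices hstack : v ∈ collectLeaders s (w₂ - 1) v₂ [v₂] ∧ v ∈ s.dag by
      rw [h, mem_orderVertices]
      have := hpath.transfer hD.closed hcons (h1 ▸ hstack.2)
      exact .inr ⟨v, hstack.1, h1 ▸ this.2, hur, h1 ▸ this.1⟩
    obtain ⟨p₁, t₁, hp₁, hvm, hvr, hvs, -⟩ := id hv
    obtain ⟨-, -, -, -, hvr₂, hvs₂, -⟩ := hv₂
    -- This event raises `decidedWave` from below `w` to `w₂ ≥ w`. If `w₂ = w`, consistency
    -- identifies the two leaders; otherwise the backward search from `v₂` passes wave `w`.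
    obtain rfl | hlt₂ := ht.eq_or_lt
    · obtain rfl := consistent_stateAt hrun hrb hp₁ hq t₁ t v hvm v₂ (h1 ▸ hmem)
        (ref_eq_iff.mpr ⟨by dsimp only at *; omega, hvs.trans hvs₂.symm⟩)
      exact ⟨subset_collectLeaders _ _ _ _ (List.mem_singleton_self _), hmem⟩
    · dsimp only at hlt₂
      have key : ∀ z ∈ s.dag, 4 * w < z.round → StrongPath s.dag z v ∧ v ∈ s.dag := by
        rw [h1]
        exact fun z hz hr => hv.strongPath hrun hrb hq hz hr
      have hvd := (key v₂ hmem (by omega)).2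
      refine ⟨mem_collectLeaders (w := w) ?_ (by omega) (fun z hz hr => (key z hz hr).1) (by omega)
        hmem (by omega) _, hvd⟩
      exact waveLeader_eq_some (h1 ▸ hD.consistent) hvd hvr
        (by rw [h4 w hlt₂.le, hvs])

/-- Agreement in a run in which infinitely many waves are decided. -/
theorem IsRun.aDelivers (hrun : IsRun P e) (hrb : ReliableBroadcast e) {X : ℕ → Proc f}
    (hcoin : ∀ t p w l, e t = .act p (.coinReturn w l) → ¬ CorruptedBefore e t p → l = X w)
    (hp : Correct e p) (hq : Correct e q)
    (hdec : ∀ w, ∃ t, w ≤ (stateAt P e q t).decidedWave) {b : B} {r : ℕ} {k : Proc f}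
    (h : ADelivers P e p b r k) : ADelivers P e q b r k := by
  obtain ⟨t, ht⟩ := h
  obtain ⟨u, hu, ho⟩ :=
    ((hrun.codeInvariant t (hp.not_corruptedBefore t)).mem_outputs _).mp ht
  obtain ⟨hur, w, v, hv, t₁, hpath⟩ := hrun.exists_committed hcoin hp hu
  obtain ⟨t₂, ht₂⟩ := hdec w
  refine ⟨t₂, ((hrun.codeInvariant t₂ (hq.not_corruptedBefore t₂)).mem_outputs _).mpr ⟨u, ?_, ho⟩⟩
  exact hrun.mem_deliveredVertices hrb hcoin hp hq hv hpath hur ht₂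

end Waves

/-! ## The probability that a leader is in the core -/

/-- Countability of the events leaves only countably many finite prefixes of runs, so every property
of a prefix defines a measurable set. -/
instance [Countable B] : Countable (Vertex f B) :=
  Function.Injective.countable
    (f := fun v : Vertex f B => (v.round, v.source, v.block, v.strongEdges, v.weakEdges))
    fun ⟨_, _, _, _, _⟩ ⟨_, _, _, _, _⟩ h => by simpa using h

instance [Countable B] : Countable (Action f B) := by
  refine Function.Surjective.countable (α := (B × ℕ) ⊕ (Vertex f B × ℕ) ⊕
    (Vertex f B × ℕ × Proc f) ⊕ Vertex f B ⊕ Unit ⊕ ℕ ⊕ (ℕ × Proc f))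
    (f := Sum.elim (fun x => .abcast x.1 x.2) <| Sum.elim (fun x => .rbcast x.1 x.2) <|
      Sum.elim (fun x => .rdeliver x.1 x.2.1 x.2.2) <| Sum.elim .addVertex <|
      Sum.elim (fun _ => .advance) <| Sum.elim .chooseLeader fun x => .coinReturn x.1 x.2) ?_
  rintro (⟨b, r⟩ | ⟨m, r⟩ | ⟨m, r, k⟩ | v | _ | w | ⟨w, l⟩)
  · exact ⟨.inl (b, r), rfl⟩
  · exact ⟨.inr (.inl (m, r)), rfl⟩
  · exact ⟨.inr (.inr (.inl (m, r, k))), rfl⟩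
  · exact ⟨.inr (.inr (.inr (.inl v))), rfl⟩
  · exact ⟨.inr (.inr (.inr (.inr (.inl ())))), rfl⟩
  · exact ⟨.inr (.inr (.inr (.inr (.inr (.inl w))))), rfl⟩
  · exact ⟨.inr (.inr (.inr (.inr (.inr (.inr (w, l)))))), rfl⟩

instance [Countable B] : Countable (Event f B) := by
  refine Function.Surjective.countable (α := (Proc f × Action f B) ⊕ Proc f ⊕ Unit)
    (f := Sum.elim (fun x => .act x.1 x.2) <| Sum.elim .corrupt fun _ => .idle) ?_
  rintro (⟨p, a⟩ | p | _)
  · exact ⟨.inl (p, a), rfl⟩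
  · exact ⟨.inr (.inl p), rfl⟩
  · exact ⟨.inr (.inr ()), rfl⟩

theorem stateAt_congr {P : Params f B} {e e' : ℕ → Event f B} {p : Proc f} {t : ℕ}
    (h : ∀ s < t, e s = e' s) : stateAt P e p t = stateAt P e' p t := by
  induction t with
  | zero => rfl
  | succ t ih =>
    simp only [stateAt]
    rw [ih fun s hs => h s (by omega), h t (Nat.lt_succ_self t)]

theorem earlyCall_congr {e e' : ℕ → Event f B} {p : Proc f} {w t : ℕ}
    (h : ∀ s ≤ t, e s = e' s) : EarlyCall e p w t ↔ EarlyCall e' p w t := by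
  have hlt : ∀ (Q : Event f B → Prop), (∃ s < t, Q (e s)) ↔ ∃ s < t, Q (e' s) := fun Q =>
    exists_congr fun s => and_congr_right fun hs => by rw [h s hs.le]
  have hall : (∀ s < t, e s ≠ .act p (.chooseLeader w)) ↔
      ∀ s < t, e' s ≠ .act p (.chooseLeader w) :=
    forall₂_congr fun s hs => by rw [h s hs.le]
  have hcall : callers e w t = callers e' w t := by
    ext q
    rw [mem_callers, mem_callers]
    exact hlt fun x => x = .act q (.chooseLeader w)
  unfold EarlyCall CorruptedBefore
  rw [h t le_rfl, hall, hcall, hlt fun x => x = .corrupt p]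

section Probability

variable {Ω : Type*} {mΩ : MeasurableSpace Ω} {μ : Measure Ω} {ℱ : Filtration ℕ mΩ}
  {run : Ω → ℕ → Event f B} {X : ℕ → Ω → Proc f} {ε : ℝ}

/-- What depends only on the events up to number `t` is measurable at time `t`. -/
theorem measurableSet_of_prefix [Countable B]
    (h_adapted : ∀ t a, MeasurableSet[ℱ t] {ω | run ω t = a}) (t : ℕ)
    (Q : (ℕ → Event f B) → Prop) (hQ : ∀ e e', (∀ s ≤ t, e s = e' s) → (Q e ↔ Q e')) :
    MeasurableSet[ℱ t] {ω | Q (run ω)} := by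
  have heq : {ω | Q (run ω)} = ⋃ h : {h : Fin (t + 1) → Event f B // ∃ e, Q e ∧ ∀ s, e s.1 = h s},
      ⋂ s : Fin (t + 1), {ω | run ω s = h.1 s} := by
    ext ω
    simp only [Set.mem_ofPred_eq, Set.mem_iUnion, Set.mem_iInter]
    constructor
    · exact fun h => ⟨⟨fun s => run ω s, run ω, h, fun _ => rfl⟩, fun _ => rfl⟩
    · rintro ⟨⟨h, e, he, heh⟩, hω⟩
      exact (hQ _ _ fun s hs => (heh ⟨s, by omega⟩).trans (hω ⟨s, by omega⟩).symm).mp he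
  rw [heq]
  refine MeasurableSet.iUnion fun h => MeasurableSet.iInter fun s => ?_
  exact ℱ.mono (Nat.lt_succ_iff.mp s.2) _ (h_adapted _ _)

variable [IsProbabilityMeasure μ]

/-- On `G` the coin is not yet revealed, so the pointwise bound on the conditional probability can
be integrated over the `ℱ t`-measurable set `G`. -/
theorem PerfectCoin.measureReal_inter_le (h : PerfectCoin μ ℱ run X ε) {w t : ℕ} {G : Set Ω}
    (hG : MeasurableSet[ℱ t] G) (hsub : ∀ ω ∈ G, (callers (run ω) w t).card < f + 1)
    (j : Proc f) :
    μ.real (G ∩ {ω | X w ω = j}) ≤ (1 / (3 * f + 1 : ℝ) + ε) * μ.real G := by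
  have hX : MeasurableSet {ω | X w ω = j} := h.measurable w (measurableSet_singleton j)
  have hint : Integrable ({ω | X w ω = j}.indicator fun _ => (1 : ℝ)) μ :=
    (integrable_const 1).indicator hX
  have h1 : ∫ ω in G, ({ω | X w ω = j}.indicator fun _ => (1 : ℝ)) ω ∂μ =
      μ.real (G ∩ {ω | X w ω = j}) := by
    rw [setIntegral_indicator hX, setIntegral_const, smul_eq_mul, mul_one]
  rw [← h1, ← setIntegral_condExp (ℱ.le t) hint hG]
  calc ∫ ω in G, (μ[{ω | X w ω = j}.indicator fun _ => (1 : ℝ) | ℱ t]) ω ∂μ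
      ≤ ∫ _ω in G, (1 / (3 * f + 1 : ℝ) + ε) ∂μ := by
        refine setIntegral_mono_on_ae integrable_condExp.integrableOn
          (integrable_const _).integrableOn (ℱ.le t _ hG) ?_
        filter_upwards [h.unpredictability w j t] with ω hω hωG
        rw [← h.fairness w j]
        exact hω (hsub ω hωG)
    _ = _ := by rw [setIntegral_const, smul_eq_mul, mul_comm]

/-- As long as the leader is not revealed, it is in any given set of `2 f + 1` processes with
probability bounded from below. -/
theorem PerfectCoin.le_measureReal_inter (h : PerfectCoin μ ℱ run X ε) {w t : ℕ} {G : Set Ω}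
    (hG : MeasurableSet[ℱ t] G) (hsub : ∀ ω ∈ G, (callers (run ω) w t).card < f + 1)
    {S : Finset (Proc f)} (hS : 2 * f + 1 ≤ S.card) :
    (1 - f * max (1 / (3 * f + 1 : ℝ) + ε) 0) * μ.real G ≤ μ.real (G ∩ {ω | X w ω ∈ S}) := by
  have hX : MeasurableSet {ω | X w ω ∈ S} := h.measurable w S.measurableSet
  have hsplit := measureReal_inter_add_sdiff (μ := μ) (s := G) hX
  have hcard : (Sᶜ.card : ℝ) ≤ f := by
    rw [Finset.card_compl, Fintype.card_fin]
    exact_mod_cast (by omega : 3 * f + 1 - S.card ≤ f)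
  -- Union bound over the at most `f` processes outside `S`. The maximum with 0 keeps the factor
  -- nonnegative, which replacing the cardinality by `f` requires.
  have hle : μ.real (G \ {ω | X w ω ∈ S}) ≤ f * max (1 / (3 * f + 1 : ℝ) + ε) 0 * μ.real G :=
    calc μ.real (G \ {ω | X w ω ∈ S})
        ≤ μ.real (⋃ j ∈ Sᶜ, G ∩ {ω | X w ω = j}) := by
          refine measureReal_mono (fun ω hω => ?_) (measure_ne_top _ _)
          simp only [Set.mem_iUnion]
          exact ⟨X w ω, Finset.mem_compl.mpr hω.2, hω.1, rfl⟩
      _ ≤ ∑ j ∈ Sᶜ, μ.real (G ∩ {ω | X w ω = j}) := measureReal_biUnion_finset_le _ _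
      _ ≤ ∑ _j ∈ Sᶜ, max (1 / (3 * f + 1 : ℝ) + ε) 0 * μ.real G :=
          Finset.sum_le_sum fun j _ => (h.measureReal_inter_le hG hsub j).trans
            (mul_le_mul_of_nonneg_right (le_max_left _ _) measureReal_nonneg)
      _ = Sᶜ.card * (max (1 / (3 * f + 1 : ℝ) + ε) 0 * μ.real G) := by
          rw [Finset.sum_const, nsmul_eq_mul]
      _ ≤ f * (max (1 / (3 * f + 1 : ℝ) + ε) 0 * μ.real G) :=
          mul_le_mul_of_nonneg_right hcard
            (mul_nonneg (le_max_right _ _) measureReal_nonneg)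
      _ = _ := by ring
  linarith

/-- A form of the Borel–Cantelli lemma: if each `G i` contains, up to a constant factor, the
probability of one of a family of disjoint events, then almost surely only finitely many of the
`G i` occur. -/
theorem ae_finite_of_aedisjoint {ι : Type*} [Countable ι] {G H : ι → Set Ω}
    (hH : ∀ i, MeasurableSet (H i)) (hdisj : Pairwise fun i j => AEDisjoint μ (H i) (H j))
    {δ : ℝ} (hδ : 0 < δ) (hle : ∀ i, δ * μ.real (G i) ≤ μ.real (H i)) :
    ∀ᵐ ω ∂μ, {i | ω ∈ G i}.Finite := by
  refine ae_finite_setOfPred_mem ?_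
  have h1 : ∑' i, μ (H i) ≤ 1 :=
    (tsum_meas_le_meas_iUnion_of_disjoint₀ μ (fun i => (hH i).nullMeasurableSet) hdisj).trans
      prob_le_one
  have h2 : ∀ i, ENNReal.ofReal δ * μ (G i) ≤ μ (H i) := fun i => by
    rw [← ofReal_measureReal (s := G i), ← ofReal_measureReal (s := H i),
      ← ENNReal.ofReal_mul hδ.le]
    exact ENNReal.ofReal_le_ofReal (hle i)
  have h3 : ENNReal.ofReal δ * ∑' i, μ (G i) ≤ 1 := by
    rw [← ENNReal.tsum_mul_left]
    exact (ENNReal.tsum_le_tsum h2).trans h1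
  intro htop
  rw [htop, ENNReal.mul_top (by simpa using hδ)] at h3
  exact absurd h3 (by simp)

/-- If a correct process makes early calls for infinitely many waves, then almost surely the leader
is in its core for infinitely many of them. -/
theorem PerfectCoin.ae_exists_mem_core [Countable B] {P : Params f B}
    (h : PerfectCoin μ ℱ run X ε) (hε : f * (1 / (3 * f + 1 : ℝ) + ε) < 1)
    (h_adapted : ∀ t a, MeasurableSet[ℱ t] {ω | run ω t = a})
    (h_run : ∀ᵐ ω ∂μ, IsRun P (run ω)) (h_rb : ∀ᵐ ω ∂μ, ReliableBroadcast (run ω))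
    (p : Proc f) (W : ℕ) (hW : 1 ≤ W) :
    ∀ᵐ ω ∂μ, Correct (run ω) p → (∃ᶠ w in Filter.atTop, ∃ t, EarlyCall (run ω) p w t) →
      ∃ w ≥ W, ∃ t, EarlyCall (run ω) p w t ∧ X w ω ∈ core (stateAt P (run ω) p t).dag w := by
  -- For `i = (w, t, S)`: an attempt at wave `w`, time `t`, with core `S`, where no earlier attempt
  -- from wave `W` on has succeeded. Earlier success is read off from the coin values that `p`
  -- holds, not from `X`, so that the event depends only on the prefix of the run.
  let Q : ℕ × ℕ × Finset (Proc f) → (ℕ → Event f B) → Prop := fun i e =>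
    W ≤ i.1 ∧ 2 * f + 1 ≤ i.2.2.card ∧ EarlyCall e p i.1 i.2.1 ∧
      core (stateAt P e p i.2.1).dag i.1 = i.2.2 ∧
      ∀ w', W ≤ w' → w' < i.1 → ∀ t' < i.2.1, EarlyCall e p w' t' → ∀ l,
        (stateAt P e p i.2.1).coins w' = some l → l ∉ core (stateAt P e p t').dag w'
  have hQ : ∀ i, MeasurableSet[ℱ i.2.1] {ω | Q i (run ω)} := fun i => by
    refine measurableSet_of_prefix h_adapted i.2.1 (Q i) fun e e' hee => ?_
    have hst : ∀ t ≤ i.2.1, stateAt P e p t = stateAt P e' p t := fun t ht =>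
      stateAt_congr fun s hs => hee s (by omega)
    simp only [Q]
    rw [hst _ le_rfl, earlyCall_congr hee]
    refine and_congr_right fun _ => and_congr_right fun _ => and_congr_right fun _ =>
      and_congr_right fun _ => forall_congr' fun w' => forall₂_congr fun _ _ =>
        forall₂_congr fun t' ht' => ?_
    rw [hst t' ht'.le, earlyCall_congr fun s hs => hee s (by omega)]
  have hX : ∀ i : ℕ × ℕ × Finset (Proc f), MeasurableSet {ω | X i.1 ω ∈ i.2.2} := fun i =>
    h.measurable i.1 i.2.2.measurableSet
  have hδ : 0 < 1 - f * max (1 / (3 * f + 1 : ℝ) + ε) 0 := by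
    obtain hm | hm := max_choice (1 / (3 * f + 1 : ℝ) + ε) 0 <;> rw [hm]
    · linarith
    · simp
  -- Success at `i` contradicts the last clause of `Q` at an index of a later wave, because by then
  -- `p` holds the value `X i.1`. For equal waves, the first call fixes the time, and the time fixes
  -- the core. Disjointness is only almost sure, since the coin's agreement is.
  have hdisj : Pairwise fun i j => AEDisjoint μ ({ω | Q i (run ω)} ∩ {ω | X i.1 ω ∈ i.2.2})
      ({ω | Q j (run ω)} ∩ {ω | X j.1 ω ∈ j.2.2}) := by
    intro i j hij
    rw [AEDisjoint, measure_eq_zero_iff_ae_notMem]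
    filter_upwards [h_run, h.agreement] with ω hrun hcoin
    rintro ⟨⟨hi, hiX⟩, hj, hjX⟩
    have key : ∀ i j : ℕ × ℕ × Finset (Proc f), Q i (run ω) → Q j (run ω) → X i.1 ω ∈ i.2.2 →
        ¬ i.1 < j.1 := by
      intro i j hi hj hiX hlt
      obtain ⟨l, hl⟩ := Option.ne_none_iff_exists'.mp
        (mt (hj.2.2.1.coins_eq_none_iff hrun (w' := i.1)).mp (by omega))
      have hlX := coins_stateAt (X := fun w => X w ω) hcoin hj.2.2.1.2.2.1 hl
      refine hj.2.2.2.2 i.1 hi.1 hlt i.2.1 (hj.2.2.1.lt hrun hi.2.2.1 hlt) hi.2.2.1 l hl ?_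
      rw [hi.2.2.2.1, hlX]
      exact hiX
    have h1 : i.1 = j.1 := le_antisymm (not_lt.mp (key j i hj hi hjX))
      (not_lt.mp (key i j hi hj hiX))
    have hci := hi.2.2.1
    have hcj := hj.2.2.1
    rw [← h1] at hcj
    have h2 : i.2.1 = j.2.1 := le_antisymm
      (not_lt.mp fun hlt => hci.2.1 _ hlt hcj.1) (not_lt.mp fun hlt => hcj.2.1 _ hlt hci.1)
    refine hij (Prod.ext h1 (Prod.ext h2 ?_))
    rw [← hi.2.2.2.1, ← hj.2.2.2.1, h1, h2]
  have hfin := ae_finite_of_aedisjoint (μ := μ) (G := fun i => {ω | Q i (run ω)})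
    (fun i => (ℱ.le _ _ (hQ i)).inter (hX i)) hdisj hδ fun i => by
      by_cases hcard : 2 * f + 1 ≤ i.2.2.card
      · exact h.le_measureReal_inter (hQ i) (fun ω hω => hω.2.2.1.2.2.2) hcard
      · have : {ω | Q i (run ω)} = ∅ := Set.eq_empty_of_forall_notMem fun ω hω => hcard hω.2.1
        simp [this]
  filter_upwards [h_run, h_rb, h.agreement, hfin] with ω hrun hrb hcoin hfin hp hfreq
  by_contra! hno
  obtain ⟨N, hN⟩ := (hfin.image Prod.fst).bddAbove
  obtain ⟨w, hw, t, hcall⟩ := Filter.frequently_atTop.mp hfreq (max W (N + 1))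
  have hWw : W ≤ w := (le_max_left _ _).trans hw
  have hNw : N + 1 ≤ w := (le_max_right _ _).trans hw
  obtain ⟨hinv, hhead⟩ := hcall.codeInvariant hrun
  have hround := (hinv.of_head hhead).1
  have hD := isDag_stateAt hrun hrb hp t
  obtain ⟨x, hx, hcore⟩ := exists_isHub_core hD (hW.trans hWw) (hinv.layer_card _ (by omega))
  have hcard : 2 * f + 1 ≤ (core (stateAt P (run ω) p t).dag w).card := by
    rw [hcore]
    exact card_strongSources (hD.wellFormed x hx.1 (by rw [hx.2.1]; omega))
  -- If no attempt from `W` on succeeds, every such attempt satisfies `Q`, including one at a wave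
  -- beyond the bound `N`.
  have hmem : Q (w, t, core (stateAt P (run ω) p t).dag w) (run ω) := by
    refine ⟨hWw, hcard, hcall, rfl, fun w' hw' _ t' _ hcall' l hl => ?_⟩
    rw [coins_stateAt (X := fun w => X w ω) hcoin hcall.2.2.1 hl]
    exact hno w' hw' t' hcall'
  have : w ≤ N := hN ⟨_, hmem, rfl⟩
  omega

end Probability

end DagRider

/-! ### Agreement with probability one -/

theorem mainTheorem2 {f : ℕ} {B : Type*} [Countable B] (P : DagRider.Params f B)
    {Ω : Type*} {mΩ : MeasurableSpace Ω} (μ : MeasureTheory.Measure Ω)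
    [MeasureTheory.IsProbabilityMeasure μ] (ℱ : MeasureTheory.Filtration ℕ mΩ)
    (run : Ω → ℕ → DagRider.Event f B) (X : ℕ → Ω → DagRider.Proc f) (ε : ℝ)
    (hε : f * (1 / (3 * f + 1 : ℝ) + ε) < 1)
    (h_adapted : ∀ t a, @MeasurableSet Ω (ℱ t) {ω | run ω t = a})
    (h_run : ∀ᵐ ω ∂μ, DagRider.IsRun P (run ω))
    (h_rb : ∀ᵐ ω ∂μ, DagRider.ReliableBroadcast (run ω))
    (h_coin : DagRider.PerfectCoin μ ℱ run X ε) :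
    ∀ᵐ ω ∂μ, ∀ i, DagRider.Correct (run ω) i → ∀ b r k, DagRider.ADelivers P (run ω) i b r k →
      ∀ j, DagRider.Correct (run ω) j → DagRider.ADelivers P (run ω) j b r k := by
  have hcore : ∀ᵐ ω ∂μ, ∀ (p : DagRider.Proc f) (W : ℕ), 1 ≤ W → DagRider.Correct (run ω) p →
      (∃ᶠ w in Filter.atTop, ∃ t, DagRider.EarlyCall (run ω) p w t) →
      ∃ w ≥ W, ∃ t, DagRider.EarlyCall (run ω) p w t ∧
        X w ω ∈ DagRider.core (DagRider.stateAt P (run ω) p t).dag w :=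
    MeasureTheory.ae_all_iff.mpr fun p => MeasureTheory.ae_all_iff.mpr fun W =>
      MeasureTheory.ae_all_iff.mpr fun hW =>
        h_coin.ae_exists_mem_core hε h_adapted h_run h_rb p W hW
  filter_upwards [h_run, h_rb, h_coin.agreement, h_coin.termination, hcore]
    with ω hrun hrb hcoin hterm hcore i hi b r k hdel j hj
  have hret := fun w => hrun.exists_coinReturn hrb hterm w
  have hcall : ∀ w, ∃ p, DagRider.Correct (run ω) p ∧ ∃ t, DagRider.EarlyCall (run ω) p w t :=
    fun w => hrun.exists_earlyCall (hrun.exists_card_callers fun p hp => (hret w p hp).1)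
  obtain ⟨p, hp, hfreq⟩ : ∃ p, DagRider.Correct (run ω) p ∧
      ∃ᶠ w in Filter.atTop, ∃ t, DagRider.EarlyCall (run ω) p w t := by
    -- Pigeonhole over the finitely many processes: otherwise, from some wave on, no correct process
    -- would make an early call.
    by_contra! hno
    obtain ⟨w, hw⟩ := (Filter.eventually_all.mpr fun p => Filter.eventually_imp_distrib_left.mpr
      (hno p)).exists
    obtain ⟨p, hp, t, ht⟩ := hcall w
    exact hw p hp t ht
  refine hrun.aDelivers (X := fun w => X w ω) hrb hcoin hi hj (fun W => ?_) hdel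
  -- The bound `W + 1` makes the wave positive, as the round `4 * w - 3` in `core` requires.
  obtain ⟨w, hw, t, hearly, hX⟩ := hcore p (W + 1) (Nat.le_add_left 1 W) hp hfreq
  obtain ⟨t', ht'⟩ := hrun.exists_decidedWave_eq (X := fun w => X w ω) hrb hcoin hp hj (by omega)
    hearly hX (hret w j hj).2
  exact ⟨t', by omega⟩
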